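/- Let $F$ be a field of characteristic different from $2,3,5$, let $D\in \mathrm{Der}_{\mathbb Z}(F,F)$, and write $D\log x=D(x)/x$ for $x\in F^\times$ and $F^{\bullet\bullet}=F\setminus\{0,1\}$. Let $V$ be a three-dimensional $F$-vector space, $\omega$ a nonzero alternating $3$-form on $V$, and $\Delta(x,y,z)=\omega(x,y,z)$. **Grassmannian complex.** $C_m(3)$ is the free abelian group on the $GL(V)$-orbits of $m$-tuples $(l_0,\dots,l_{m-1})$ of vectors of $V$ in generic position (any three or fewer of them are linearly independent), and $d(l_0,\dots,l_m)=\sum_{i=0}^m(-1)^i(l_0,\dots,\hat l_i,\dots,l_m)$. **Infinitesimal complex.** All tensor products are over $\mathbb Z$. - $\mathcal B_2(F)$ is the quotient of $\mathbb Z[F^{\bullet\bullet}]$ by the subgroup generated by $\sum_{i=0}^4(-1)^i[r(x_0,\dots,\hat x_i,\dots,x_4)]$ for pairwise distinct $x_0,\dots,x_4\in\mathbb P^1(F)$, where $r(x_0,x_1,x_2,x_3)=\frac{(x_0-x_3)(x_1-x_2)}{(x_0-x_2)(x_1-x_3)}$; $[a]_2$ is the class of $[a]$. - For $a\in F^{\bullet\bullet}$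 let $[\![a]\!]^D=\frac{D(a)}{a(1-a)}[a]$ in the $F$-vector space $F[F^{\bullet\bullet}]$ with basis $F^{\bullet\bullet}$. $\beta^D_2(F)$ is the $F$-subspace spanned by the classes $[\![a]\!]^D_2$ of the $[\![a]\!]^D$ in the quotient of $F[F^{\bullet\bullet}]$ by the span of the elements $[\![a]\!]^D-[\![b]\!]^D+[\![\frac ba]\!]^D-[\![\frac{1-b}{1-a}]\!]^D+[\![\frac{1-b^{-1}}{1-a^{-1}}]\!]^D$, $a\ne b$ in $F^{\bullet\bullet}$. - $\beta^D_3(F)$ is the quotient of $F[F^{\bullet\bullet}]$ by the kernel of the $F$-linear map to $(\beta^D_2(F)\otimes F^\times)\oplus(F\otimes\mathcal B_2(F))$ that sends $[\![a]\!]^D$ to $[\![a]\!]^D_2\otimes a+D\log(a)\otimes[a]_2$ (and $[a]$ to $0$ when $D(a)=0$); $[\![a]\!]_3^D$ is the class of $[\![a]\!]^D$, and $[\![1]\!]^D_3:=0$. - The differentials are $\partial[\![a]\!]^D_3=[\![a]\!]^D_2\otimes a+D\log(a)\otimes[a]_2$ and $$\partial([\![a]\!]^D_2\otimes b+x\otimes[y]_2)=D\log(1-a)\otimes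 a\wedge b-D\log(a)\otimes(1-a)\wedge b+x\otimes(1-y)\wedge y .$$ **The maps.** Put $r(x|y_0,y_1,y_2,y_3)=\frac{\Delta(x,y_0,y_3)\Delta(x,y_1,y_2)}{\Delta(x,y_0,y_2)\Delta(x,y_1,y_3)}$. With $\Delta_i=\Delta(l_0,\dots,\hat l_i,\dots,l_3)$ (indices mod $4$), $\Delta(\hat l_i,\hat l_j)$ the determinant of the three vectors left from $l_0,\dots,l_4$ after omitting $l_i,l_j$, and $P_i=\prod_{j\ne i}\Delta(\hat l_i,\hat l_j)$, let $$\tau^3_0(l_0,\dots,l_3)=\sum_{i=0}^3(-1)^i\,D\log\Delta_i\otimes\frac{\Delta_{i+1}}{\Delta_{i+2}}\wedge\frac{\Delta_{i+3}}{\Delta_{i+2}},$$ $$\tau^3_1(l_0,\dots,l_4)=-\frac13\sum_{i=0}^4(-1)^i\Big([\![r(l_i|l_0,\dots,\hat l_i,\dots,l_4)]\!]^D_2\otimes P_i+D\log P_i\otimes[r(l_i|l_0,\dots,\hat l_i,\dots,l_4)]_2\Big),$$ $$\tau^3_2(l_0,\dots,l_5)=-\frac1{90}\sum_{\sigma\in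 S_6}\mathrm{sgn}(\sigma)\left[\!\!\left[\frac{\Delta(l_{\sigma0},l_{\sigma1},l_{\sigma3})\,\Delta(l_{\sigma1},l_{\sigma2},l_{\sigma4})\,\Delta(l_{\sigma2},l_{\sigma0},l_{\sigma5})}{\Delta(l_{\sigma0},l_{\sigma1},l_{\sigma4})\,\Delta(l_{\sigma1},l_{\sigma2},l_{\sigma5})\,\Delta(l_{\sigma2},l_{\sigma0},l_{\sigma3})}\right]\!\!\right]^D_3 .$$ These are well defined on configurations. **Claim.** In the diagram with rows $C_6(3)\xrightarrow{d}C_5(3)\xrightarrow{d}C_4(3)$ and $\beta^D_3(F)\xrightarrow{\partial}(\beta^D_2(F)\otimes F^\times)\oplus(F\otimes\mathcal B_2(F))\xrightarrow{\partial}F\otimes\bigwedge^2F^\times$ and vertical maps $\tau^3_2,\tau^3_1,\tau^3_0$, both rows are complexes ($d\circ d=0$, $\partial\circ\partial=0$) and both squares commute: $$\partial\circ\tau^3_2=\tau^3_1\circ d,\qquad \partial\circ\tau^3_1=\tau^3_0\circ d .$$ So $(\tau^3_2,\tau^3_1,\tau^3_0)$ is a morphism of complexes. -/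

import Mathlib

open scoped TensorProduct

noncomputable section

namespace WeightThree

/-! ## Symbols over a field -/

section Symbols

variable {F : Type*} [Field F]

/-- The doubly punctured affine line `F ∖ {0, 1}`. -/
abbrev Punctured (F : Type*) [Field F] : Type _ := {a : F // a ≠ 0 ∧ a ≠ 1}

/-- The multiplicative group of `F`, written additively (a `ℤ`-module). -/
abbrev MulGroup (F : Type*) [Field F] : Type _ := Additive Fˣ

/-- A nonzero element of `F` as an element of the multiplicative group
(the value at `0`, which is never used, is the neutral element). -/
def unitOf (x : F) : MulGroup F :=
  open Classical in if h : x = 0 then 0 else Additive.ofMul (Units.mk0 x h)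

/-- The logarithmic derivative `D(x) / x`. -/
def dlog (D : Derivation ℤ F F) (x : F) : F := D x / x

/-- The second exterior power of the multiplicative group, over `ℤ`. -/
abbrev Wedge2 (F : Type*) [Field F] : Type _ := ⋀[ℤ]^2 (MulGroup F)

/-- The element `a ∧ b`. -/
def wedge (a b : MulGroup F) : Wedge2 F := exteriorPower.ιMulti ℤ 2 ![a, b]

/-! ### The group `B₂(F)` -/

/-- The generator `[x]` of the free abelian group on `F ∖ {0, 1}`; `[x] = 0` for `x = 0, 1`. -/
def intSymb (x : F) : FreeAbelianGroup (Punctured F) :=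
  open Classical in if h : x ≠ 0 ∧ x ≠ 1 then FreeAbelianGroup.of ⟨x, h⟩ else 0

/-- The `2 × 2` determinant. -/
def det2 (u v : Fin 2 → F) : F := u 0 * v 1 - u 1 * v 0

/-- The cross-ratio of four points of the projective line given by homogeneous coordinates. -/
def crossRatio (p : Fin 4 → Fin 2 → F) : F :=
  (det2 (p 0) (p 3) * det2 (p 1) (p 2)) / (det2 (p 0) (p 2) * det2 (p 1) (p 3))

/-- The subgroup generated by the five-term relations of the cross-ratio, one for each
quintuple of pairwise distinct points of the projective line. -/
def R2 (F : Type*) [Field F] : AddSubgroup (FreeAbelianGroup (Punctured F)) :=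
  AddSubgroup.closure
    {z | ∃ p : Fin 5 → Fin 2 → F, (∀ i j, i ≠ j → det2 (p i) (p j) ≠ 0) ∧
      z = ∑ i : Fin 5, (-1 : ℤ) ^ (i : ℕ) • intSymb (crossRatio fun k => p (i.succAbove k))}

/-- The group `B₂(F)`. -/
abbrev B2 (F : Type*) [Field F] : Type _ := FreeAbelianGroup (Punctured F) ⧸ R2 F

/-- The class `[x]₂` in `B₂(F)`. -/
def symbB2 (x : F) : B2 F := QuotientAddGroup.mk (intSymb x)

/-! ### The vector spaces `β₂ᴰ(F)` and `β₃ᴰ(F)` -/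

/-- The element `⟦x⟧ᴰ = D(x) / (x (1 - x)) [x]` of the `F`-vector space with basis
`F ∖ {0, 1}`; it is `0` for `x = 0, 1`. -/
def symb (D : Derivation ℤ F F) (x : F) : Punctured F →₀ F :=
  open Classical in
  if h : x ≠ 0 ∧ x ≠ 1 then Finsupp.single ⟨x, h⟩ (D x / (x * (1 - x))) else 0

/-- The subspace spanned by the five-term relations between the elements `⟦x⟧ᴰ`. -/
def fiveTerm (D : Derivation ℤ F F) : Submodule F (Punctured F →₀ F) :=
  Submodule.span F
    {z | ∃ a b : F, a ≠ 0 ∧ a ≠ 1 ∧ b ≠ 0 ∧ b ≠ 1 ∧ a ≠ b ∧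
      z = symb D a - symb D b + symb D (b / a) - symb D ((1 - b) / (1 - a))
        + symb D ((1 - b⁻¹) / (1 - a⁻¹))}

/-- `β₂ᴰ(F)`: the subspace of `F[F ∖ {0, 1}] / (five-term relations)` generated by
the classes of the elements `⟦x⟧ᴰ`. -/
abbrev beta2Sub (D : Derivation ℤ F F) : Submodule F ((Punctured F →₀ F) ⧸ fiveTerm D) :=
  Submodule.span F (Set.range fun x : F => (fiveTerm D).mkQ (symb D x))

abbrev Beta2 (D : Derivation ℤ F F) : Type _ := ↥(beta2Sub D)

/-- The class `⟦x⟧₂ᴰ` in `β₂ᴰ(F)`. -/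
def symb2 (D : Derivation ℤ F F) (x : F) : Beta2 D :=
  ⟨(fiveTerm D).mkQ (symb D x), Submodule.subset_span ⟨x, rfl⟩⟩

/-- The middle term `(β₂ᴰ(F) ⊗ F^×) ⊕ (F ⊗ B₂(F))` of the infinitesimal complex. -/
abbrev Mid (D : Derivation ℤ F F) : Type _ :=
  (Beta2 D ⊗[ℤ] MulGroup F) × (F ⊗[ℤ] B2 F)

/-- The `F`-linear map `F[F ∖ {0, 1}] → (β₂ᴰ(F) ⊗ F^×) ⊕ (F ⊗ B₂(F))` with
`⟦a⟧ᴰ ↦ ⟦a⟧₂ᴰ ⊗ a + (D(a) / a) ⊗ [a]₂` (see `bdry3Pre_symb`). A generator `[a]` with `D(a) = 0` is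
not a multiple of `⟦a⟧ᴰ = 0` and is sent to `0`, so that it dies in `β₃ᴰ(F)`: this quotient is
spanned by the classes of the `⟦a⟧ᴰ`. -/
def bdry3Pre (D : Derivation ℤ F F) : (Punctured F →₀ F) →ₗ[F] Mid D :=
  Finsupp.linearCombination F fun a : Punctured F =>
    (D a.1 / (a.1 * (1 - a.1)))⁻¹ •
      ((symb2 D a.1 ⊗ₜ[ℤ] unitOf a.1, dlog D a.1 ⊗ₜ[ℤ] symbB2 a.1) : Mid D)

/-- `β₃ᴰ(F)`: the quotient of `F[F ∖ {0, 1}]` by the kernel of `bdry3Pre`. -/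
abbrev Beta3 (D : Derivation ℤ F F) : Type _ :=
  (Punctured F →₀ F) ⧸ LinearMap.ker (bdry3Pre D)

/-- The class `⟦x⟧₃ᴰ` in `β₃ᴰ(F)`. -/
def symb3 (D : Derivation ℤ F F) (x : F) : Beta3 D :=
  (LinearMap.ker (bdry3Pre D)).mkQ (symb D x)

/-- The differential `β₃ᴰ(F) → (β₂ᴰ(F) ⊗ F^×) ⊕ (F ⊗ B₂(F))`. -/
def bdry3 (D : Derivation ℤ F F) : Beta3 D →ₗ[F] Mid D :=
  (LinearMap.ker (bdry3Pre D)).liftQ (bdry3Pre D) le_rfl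

/-! ### Well-definedness of the second differential -/

lemma unitOf_mul {x y : F} (hx : x ≠ 0) (hy : y ≠ 0) :
    unitOf (x * y) = unitOf x + unitOf y := by
  simp only [unitOf, hx, hy, mul_ne_zero hx hy, dif_neg, not_false_eq_true, ← ofMul_mul]
  congr 1
  ext
  simp

lemma unitOf_div {x y : F} (hx : x ≠ 0) (hy : y ≠ 0) :
    unitOf (x / y) = unitOf x - unitOf y := by
  rw [eq_sub_iff_add_eq, ← unitOf_mul (div_ne_zero hx hy) hy, div_mul_cancel₀ _ hy]

lemma dlog_mul (D : Derivation ℤ F F) {x y : F} (hx : x ≠ 0) (hy : y ≠ 0) :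
    dlog D (x * y) = dlog D x + dlog D y := by
  simp only [dlog, Derivation.leibniz, smul_eq_mul]
  field_simp
  ring

lemma dlog_div (D : Derivation ℤ F F) {x y : F} (hx : x ≠ 0) (hy : y ≠ 0) :
    dlog D (x / y) = dlog D x - dlog D y := by
  rw [eq_sub_iff_add_eq, ← dlog_mul D (div_ne_zero hx hy) hy, div_mul_cancel₀ _ hy]

lemma dlog_neg (D : Derivation ℤ F F) (x : F) : dlog D (-x) = dlog D x := by
  simp [dlog]

lemma tmul_unitOf_neg [NeZero (2 : F)] (c : F) {x : F} (hx : x ≠ 0) :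
    c ⊗ₜ[ℤ] unitOf (-x) = c ⊗ₜ[ℤ] unitOf x := by
  have h1 : unitOf (-x) = unitOf (-1) + unitOf x := by
    rw [← unitOf_mul (by simp) hx, neg_one_mul]
  have h2 : (unitOf (-1 : F)) + unitOf (-1 : F) = 0 := by
    rw [← unitOf_mul (by simp) (by simp)]
    simp [unitOf]
  have h3 : c ⊗ₜ[ℤ] unitOf (-1 : F) = 0 := by
    have h4 : c = (2 : ℤ) • (c / 2) := by
      rw [zsmul_eq_mul, Int.cast_ofNat, mul_div_cancel₀ _ (NeZero.ne (2 : F))]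
    rw [h4, TensorProduct.smul_tmul, two_zsmul, h2, TensorProduct.tmul_zero]
  rw [h1, TensorProduct.tmul_add, h3, zero_add]

lemma update_zero_pair (x y z : MulGroup F) : Function.update ![x, y] 0 z = ![z, y] := by
  ext k; fin_cases k <;> rfl

lemma update_one_pair (x y z : MulGroup F) : Function.update ![x, y] 1 z = ![x, z] := by
  ext k; fin_cases k <;> rfl

/-- The bilinear map `(a, b) ↦ a ∧ b`. -/
def wedgeBilin (F : Type*) [Field F] : MulGroup F →ₗ[ℤ] MulGroup F →ₗ[ℤ] Wedge2 F :=
  LinearMap.mk₂ ℤ wedge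
    (fun a a' b => by
      have := (exteriorPower.ιMulti ℤ 2 (M := MulGroup F)).map_update_add ![0, b] 0 a a'
      simpa only [update_zero_pair, wedge] using this)
    (fun c a b => by
      have := (exteriorPower.ιMulti ℤ 2 (M := MulGroup F)).map_update_smul ![0, b] 0 c a
      simpa only [update_zero_pair, wedge] using this)
    (fun a b b' => by
      have := (exteriorPower.ιMulti ℤ 2 (M := MulGroup F)).map_update_add ![a, 0] 1 b b'
      simpa only [update_one_pair, wedge] using this)
    (fun c a b => by
      have := (exteriorPower.ιMulti ℤ 2 (M := MulGroup F)).map_update_smul ![a, 0] 1 c b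
      simpa only [update_one_pair, wedge] using this)

lemma wedgeBilin_apply (a b : MulGroup F) : wedgeBilin F a b = wedge a b := rfl

lemma wedgeBilin_self (a : MulGroup F) : wedgeBilin F a a = 0 :=
  (exteriorPower.ιMulti ℤ 2 (M := MulGroup F)).map_eq_zero_of_eq ![a, a]
    (i := 0) (j := 1) rfl (by decide)

lemma wedgeBilin_swap (a b : MulGroup F) : wedgeBilin F a b = -wedgeBilin F b a := by
  have h := wedgeBilin_self (a + b)
  simp only [map_add, LinearMap.add_apply, wedgeBilin_self] at h
  rw [eq_neg_iff_add_eq_zero, ← h]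
  abel

lemma crossRatio_ne {p : Fin 4 → Fin 2 → F} (hp : ∀ i j, i ≠ j → det2 (p i) (p j) ≠ 0) :
    crossRatio p ≠ 0 ∧ crossRatio p ≠ 1 ∧
      1 - crossRatio p =
        (det2 (p 0) (p 1) * det2 (p 2) (p 3)) / (det2 (p 0) (p 2) * det2 (p 1) (p 3)) := by
  have h02 := hp 0 2 (by decide)
  have h13 := hp 1 3 (by decide)
  have h : 1 - crossRatio p =
      (det2 (p 0) (p 1) * det2 (p 2) (p 3)) / (det2 (p 0) (p 2) * det2 (p 1) (p 3)) := by
    rw [crossRatio, eq_div_iff (mul_ne_zero h02 h13), sub_mul,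
      div_mul_cancel₀ _ (mul_ne_zero h02 h13)]
    simp only [det2]
    ring
  have h0 : crossRatio p ≠ 0 :=
    div_ne_zero (mul_ne_zero (hp 0 3 (by decide)) (hp 1 2 (by decide))) (mul_ne_zero h02 h13)
  refine ⟨h0, fun h1 => ?_, h⟩
  rw [h1, sub_self] at h
  exact div_ne_zero (mul_ne_zero (hp 0 1 (by decide)) (hp 2 3 (by decide)))
    (mul_ne_zero h02 h13) h.symm

/-- The map `[x] ↦ (1 - x) ∧ x` on the free abelian group. -/
def delta2Pre (F : Type*) [Field F] : FreeAbelianGroup (Punctured F) →+ Wedge2 F :=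
  FreeAbelianGroup.lift fun a => wedge (unitOf (1 - a.1)) (unitOf a.1)

lemma delta2Pre_intSymb {x : F} (h0 : x ≠ 0) (h1 : x ≠ 1) :
    delta2Pre F (intSymb x) = wedge (unitOf (1 - x)) (unitOf x) := by
  simp [delta2Pre, intSymb, h0, h1]

lemma delta2Pre_crossRatio {p : Fin 4 → Fin 2 → F}
    (hp : ∀ i j, i ≠ j → det2 (p i) (p j) ≠ 0) :
    delta2Pre F (intSymb (crossRatio p)) =
      wedgeBilin F
        (unitOf (det2 (p 0) (p 1)) + unitOf (det2 (p 2) (p 3))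
          - (unitOf (det2 (p 0) (p 2)) + unitOf (det2 (p 1) (p 3))))
        (unitOf (det2 (p 0) (p 3)) + unitOf (det2 (p 1) (p 2))
          - (unitOf (det2 (p 0) (p 2)) + unitOf (det2 (p 1) (p 3)))) := by
  obtain ⟨h0, h1, h2⟩ := crossRatio_ne hp
  have e01 := hp 0 1 (by decide)
  have e02 := hp 0 2 (by decide)
  have e03 := hp 0 3 (by decide)
  have e12 := hp 1 2 (by decide)
  have e13 := hp 1 3 (by decide)
  have e23 := hp 2 3 (by decide)
  rw [delta2Pre_intSymb h0 h1, h2, crossRatio, wedgeBilin_apply,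
    unitOf_div (mul_ne_zero e01 e23) (mul_ne_zero e02 e13),
    unitOf_div (mul_ne_zero e03 e12) (mul_ne_zero e02 e13),
    unitOf_mul e01 e23, unitOf_mul e02 e13, unitOf_mul e03 e12]

lemma R2_le_ker : R2 F ≤ (delta2Pre F).ker := by
  rw [R2, AddSubgroup.closure_le]
  rintro z ⟨p, hp, rfl⟩
  simp only [SetLike.mem_coe, AddMonoidHom.mem_ker, map_sum, map_zsmul]
  have key : ∀ i : Fin 5, _ := fun i => delta2Pre_crossRatio (p := fun k => p (i.succAbove k))
    (fun a b hab => hp _ _ (fun h => hab (Fin.succAbove_right_injective h)))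
  simp only [key, Fin.sum_univ_five]
  have r : ∀ (i : Fin 5) (k : Fin 4), i.succAbove k = 
    (![![1,2,3,4],![0,2,3,4],![0,1,3,4],![0,1,2,4],![0,1,2,3]] : Fin 5 → Fin 4 → Fin 5) i k := by
    decide
  simp only [r, Matrix.cons_val]
  generalize unitOf (det2 (p 0) (p 1)) = a01
  generalize unitOf (det2 (p 0) (p 2)) = a02
  generalize unitOf (det2 (p 0) (p 3)) = a03
  generalize unitOf (det2 (p 0) (p 4)) = a04
  generalize unitOf (det2 (p 1) (p 2)) = a12
  generalize unitOf (det2 (p 1) (p 3)) = a13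
  generalize unitOf (det2 (p 1) (p 4)) = a14
  generalize unitOf (det2 (p 2) (p 3)) = a23
  generalize unitOf (det2 (p 2) (p 4)) = a24
  generalize unitOf (det2 (p 3) (p 4)) = a34
  simp only [map_add, map_sub, LinearMap.add_apply, LinearMap.sub_apply, wedgeBilin_self]
  simp only [wedgeBilin_swap a34 a14, wedgeBilin_swap a24 a14, wedgeBilin_swap a34 a23,
    wedgeBilin_swap a24 a23, wedgeBilin_swap a34 a13, wedgeBilin_swap a24 a13, wedgeBilin_swap
    a34 a24, wedgeBilin_swap a34 a04, wedgeBilin_swap a24 a04, wedgeBilin_swap a34 a03,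
    wedgeBilin_swap a24 a03, wedgeBilin_swap a14 a04, wedgeBilin_swap a14 a13, wedgeBilin_swap
    a14 a03, wedgeBilin_swap a24 a12, wedgeBilin_swap a14 a12, wedgeBilin_swap a24 a02,
    wedgeBilin_swap a14 a02, wedgeBilin_swap a23 a03, wedgeBilin_swap a23 a13, wedgeBilin_swap a13 a03, wedgeBilin_swap
    a23 a12, wedgeBilin_swap a13 a12, wedgeBilin_swap a23 a02, wedgeBilin_swap a13 a02]
  norm_num
  abel

/-- The map `δ : B₂(F) → ⋀² F^×`, `[x]₂ ↦ (1 - x) ∧ x`. -/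
def delta2 (F : Type*) [Field F] : B2 F →ₗ[ℤ] Wedge2 F :=
  (QuotientAddGroup.lift (R2 F) (delta2Pre F) R2_le_ker).toIntLinearMap

lemma delta2_symbB2 {x : F} (h0 : x ≠ 0) (h1 : x ≠ 1) :
    delta2 F (symbB2 x) = wedge (unitOf (1 - x)) (unitOf x) :=
  delta2Pre_intSymb h0 h1

/-- The `F`-linear map `[a] ↦ a ⊗ a + (1 - a) ⊗ (1 - a)`. -/
def bdry2Pre (F : Type*) [Field F] : (Punctured F →₀ F) →ₗ[F] F ⊗[ℤ] MulGroup F :=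
  Finsupp.linearCombination F fun a : Punctured F =>
    a.1 ⊗ₜ[ℤ] unitOf a.1 + (1 - a.1) ⊗ₜ[ℤ] unitOf (1 - a.1)

lemma bdry2Pre_symb (D : Derivation ℤ F F) {x : F} (h0 : x ≠ 0) (h1 : x ≠ 1) :
    bdry2Pre F (symb D x) =
      -(dlog D (1 - x) ⊗ₜ[ℤ] unitOf x) + dlog D x ⊗ₜ[ℤ] unitOf (1 - x) := by
  have h : (1 : F) - x ≠ 0 := sub_ne_zero.mpr (Ne.symm h1)
  simp only [bdry2Pre, symb, h0, h1, ne_eq, not_false_eq_true, and_self, dif_pos,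
    Finsupp.linearCombination_single, smul_add, TensorProduct.smul_tmul', smul_eq_mul, dlog,
    ← TensorProduct.neg_tmul]
  congr 2
  · simp only [map_sub, Derivation.map_one_eq_zero]
    field_simp
    ring
  · field_simp

lemma fiveTerm_le_ker [NeZero (2 : F)] (D : Derivation ℤ F F) :
    fiveTerm D ≤ LinearMap.ker (bdry2Pre F) := by
  rw [fiveTerm, Submodule.span_le]
  rintro z ⟨a, b, ha0, ha1, hb0, hb1, hab, rfl⟩
  have hA : 1 - a ≠ 0 := sub_ne_zero.mpr (Ne.symm ha1)
  have hB : 1 - b ≠ 0 := sub_ne_zero.mpr (Ne.symm hb1)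
  have hC : a - b ≠ 0 := sub_ne_zero.mpr hab
  have e1 : (1 - b⁻¹) / (1 - a⁻¹) = (a * (1 - b)) / (b * (1 - a)) := by
    have : a - 1 ≠ 0 := sub_ne_zero.mpr ha1
    field_simp
    ring
  have e2 : 1 - b / a = (a - b) / a := by field_simp
  have e3 : 1 - (1 - b) / (1 - a) = -((a - b) / (1 - a)) := by field_simp; ring
  have e4 : 1 - (a * (1 - b)) / (b * (1 - a)) = -((a - b) / (b * (1 - a))) := by
    field_simp; ring
  have n2 : b / a ≠ 1 := by rw [ne_eq, div_eq_one_iff_eq ha0]; exact fun h => hab h.symm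
  have n3 : (1 - b) / (1 - a) ≠ 1 := fun h => by
    rw [h, sub_self, eq_comm, neg_eq_zero] at e3
    exact div_ne_zero hC hA e3
  have n4 : (a * (1 - b)) / (b * (1 - a)) ≠ 1 := fun h => by
    rw [h, sub_self, eq_comm, neg_eq_zero] at e4
    exact div_ne_zero hC (mul_ne_zero hb0 hA) e4
  rw [e1, SetLike.mem_coe, LinearMap.mem_ker]
  simp only [map_add, map_sub]
  rw [bdry2Pre_symb D ha0 ha1, bdry2Pre_symb D hb0 hb1,
    bdry2Pre_symb D (div_ne_zero hb0 ha0) n2, bdry2Pre_symb D (div_ne_zero hB hA) n3,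
    bdry2Pre_symb D (div_ne_zero (mul_ne_zero ha0 hB) (mul_ne_zero hb0 hA)) n4, e2, e3, e4,
    tmul_unitOf_neg _ (div_ne_zero hC hA),
    tmul_unitOf_neg _ (div_ne_zero hC (mul_ne_zero hb0 hA))]
  simp only [dlog_neg, dlog_div D hC ha0, dlog_div D hC hA, dlog_div D hb0 ha0,
    dlog_div D hB hA, dlog_div D hC (mul_ne_zero hb0 hA),
    dlog_div D (mul_ne_zero ha0 hB) (mul_ne_zero hb0 hA), dlog_mul D hb0 hA, dlog_mul D ha0 hB,
    unitOf_div hC ha0, unitOf_div hC hA, unitOf_div hb0 ha0,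
    unitOf_div hB hA, unitOf_div hC (mul_ne_zero hb0 hA),
    unitOf_div (mul_ne_zero ha0 hB) (mul_ne_zero hb0 hA), unitOf_mul hb0 hA, unitOf_mul ha0 hB,
    TensorProduct.tmul_add, TensorProduct.add_tmul, TensorProduct.tmul_sub,
    TensorProduct.sub_tmul]
  abel

/-- The map `∂ᴰ : β₂ᴰ(F) → F ⊗ F^×` with
`⟦a⟧₂ᴰ ↦ -D(1 - a) / (1 - a) ⊗ a + D(a) / a ⊗ (1 - a)` (see `bdry2_symb2`). -/
def bdry2 [NeZero (2 : F)] (D : Derivation ℤ F F) : Beta2 D →ₗ[F] F ⊗[ℤ] MulGroup F :=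
  (fiveTerm D).liftQ (bdry2Pre F) (fiveTerm_le_ker D) ∘ₗ (beta2Sub D).subtype

lemma bdry2_symb2 [NeZero (2 : F)] (D : Derivation ℤ F F) {x : F} (h0 : x ≠ 0) (h1 : x ≠ 1) :
    bdry2 D (symb2 D x) =
      -(dlog D (1 - x) ⊗ₜ[ℤ] unitOf x) + dlog D x ⊗ₜ[ℤ] unitOf (1 - x) :=
  bdry2Pre_symb D h0 h1

/-- The map `(F ⊗ F^×) ⊗ F^× → F ⊗ ⋀² F^×`, `(x ⊗ a) ⊗ b ↦ x ⊗ (a ∧ b)`. -/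
def wedgeMap (F : Type*) [Field F] :
    (F ⊗[ℤ] MulGroup F) ⊗[ℤ] MulGroup F →ₗ[F] F ⊗[ℤ] Wedge2 F :=
  TensorProduct.AlgebraTensorModule.map LinearMap.id (TensorProduct.lift (wedgeBilin F)) ∘ₗ
    (TensorProduct.AlgebraTensorModule.assoc ℤ ℤ F F (MulGroup F) (MulGroup F)).toLinearMap

lemma wedgeMap_tmul (x : F) (a b : MulGroup F) :
    wedgeMap F ((x ⊗ₜ[ℤ] a) ⊗ₜ[ℤ] b) = x ⊗ₜ[ℤ] wedge a b := rfl

/-- The differential `(β₂ᴰ(F) ⊗ F^×) ⊕ (F ⊗ B₂(F)) → F ⊗ ⋀² F^×`. -/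
def bdryMid [NeZero (2 : F)] (D : Derivation ℤ F F) : Mid D →ₗ[F] F ⊗[ℤ] Wedge2 F :=
  LinearMap.coprod
    (-(wedgeMap F ∘ₗ TensorProduct.AlgebraTensorModule.map (bdry2 D) LinearMap.id))
    (TensorProduct.AlgebraTensorModule.map LinearMap.id (delta2 F))

lemma bdryMid_apply [NeZero (2 : F)] (D : Derivation ℤ F F) {a y : F} (x : F) (b : MulGroup F)
    (ha0 : a ≠ 0) (ha1 : a ≠ 1) (hy0 : y ≠ 0) (hy1 : y ≠ 1) :
    bdryMid D (symb2 D a ⊗ₜ[ℤ] b, x ⊗ₜ[ℤ] symbB2 y) =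
      dlog D (1 - a) ⊗ₜ[ℤ] wedge (unitOf a) b - dlog D a ⊗ₜ[ℤ] wedge (unitOf (1 - a)) b
        + x ⊗ₜ[ℤ] wedge (unitOf (1 - y)) (unitOf y) := by
  simp only [bdryMid, LinearMap.coprod_apply, LinearMap.neg_apply, LinearMap.comp_apply,
    TensorProduct.AlgebraTensorModule.map_tmul, bdry2_symb2 D ha0 ha1, LinearMap.id_apply,
    TensorProduct.add_tmul, TensorProduct.neg_tmul, map_add, map_neg, wedgeMap_tmul,
    delta2_symbB2 hy0 hy1]
  abel

lemma bdry3Pre_symb (D : Derivation ℤ F F) {x : F} (h0 : x ≠ 0) (h1 : x ≠ 1) :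
    bdry3Pre D (symb D x) = (symb2 D x ⊗ₜ[ℤ] unitOf x, dlog D x ⊗ₜ[ℤ] symbB2 x) := by
  have h : (1 : F) - x ≠ 0 := sub_ne_zero.mpr (Ne.symm h1)
  by_cases hD : D x = 0
  · have hs : symb D x = 0 := by simp [symb, hD]
    have hs2 : symb2 D x = 0 := by
      apply Subtype.ext
      simp [symb2, hs]
    simp only [hs, hs2, dlog, hD, map_zero, zero_div, TensorProduct.zero_tmul]
    rfl
  · have hc : D x / (x * (1 - x)) ≠ 0 := div_ne_zero hD (mul_ne_zero h0 h)
    simp only [bdry3Pre, symb, h0, h1, ne_eq, not_false_eq_true, and_self, dif_pos,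
      Finsupp.linearCombination_single, smul_smul, mul_inv_cancel₀ hc, one_smul]

lemma bdry3_symb3 (D : Derivation ℤ F F) {x : F} (h0 : x ≠ 0) (h1 : x ≠ 1) :
    bdry3 D (symb3 D x) = (symb2 D x ⊗ₜ[ℤ] unitOf x, dlog D x ⊗ₜ[ℤ] symbB2 x) :=
  bdry3Pre_symb D h0 h1

/-! ### Consequences of the five-term relation -/

lemma symb2_fiveTerm (D : Derivation ℤ F F) {a b : F} (ha0 : a ≠ 0) (ha1 : a ≠ 1)
    (hb0 : b ≠ 0) (hb1 : b ≠ 1) (hab : a ≠ b) :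
    symb2 D a - symb2 D b + symb2 D (b / a) - symb2 D ((1 - b) / (1 - a))
      + symb2 D ((1 - b⁻¹) / (1 - a⁻¹)) = 0 := by
  apply Subtype.ext
  have h : (fiveTerm D).mkQ (symb D a - symb D b + symb D (b / a) - symb D ((1 - b) / (1 - a))
      + symb D ((1 - b⁻¹) / (1 - a⁻¹))) = 0 := by
    rw [← LinearMap.mem_ker, Submodule.ker_mkQ]
    exact Submodule.subset_span ⟨a, b, ha0, ha1, hb0, hb1, hab, rfl⟩
  simp only [map_add, map_sub] at h
  exact h

lemma symb2_inv_aux (D : Derivation ℤ F F) {u w : F} (hu0 : u ≠ 0) (hu1 : u ≠ 1)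
    (hw0 : w ≠ 0) (hw1 : w ≠ 1) (huw : u ≠ w) :
    symb2 D u + symb2 D u⁻¹ - (symb2 D w + symb2 D w⁻¹)
      + (symb2 D (w / u) + symb2 D (u / w)) = 0 := by
  have hC : u - w ≠ 0 := sub_ne_zero.mpr huw
  have hW : 1 - w ≠ 0 := sub_ne_zero.mpr (Ne.symm hw1)
  have hU : u - 1 ≠ 0 := sub_ne_zero.mpr hu1
  obtain ⟨a, ha⟩ : ∃ a, a = (1 - w) / (u - w) := ⟨_, rfl⟩
  obtain ⟨b, hb⟩ : ∃ b, b = u * a := ⟨_, rfl⟩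
  have ha0 : a ≠ 0 := ha ▸ div_ne_zero hW hC
  have hb0 : b ≠ 0 := hb ▸ mul_ne_zero hu0 ha0
  have hA : 1 - a = (u - 1) / (u - w) := by rw [ha]; field_simp; ring
  have hB : 1 - b = w * (1 - a) := by rw [hA, hb, ha]; field_simp; ring
  have hA0 : 1 - a ≠ 0 := hA ▸ div_ne_zero hU hC
  have hB0 : 1 - b ≠ 0 := hB ▸ mul_ne_zero hw0 hA0
  have ha1 : a ≠ 1 := fun h => hA0 (by rw [h, sub_self])
  have hb1 : b ≠ 1 := fun h => hB0 (by rw [h, sub_self])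
  have hab : a ≠ b := fun h => hu1 (mul_right_cancel₀ ha0 (by rw [one_mul, ← hb, ← h]))
  have e1 : b / a = u := by rw [hb, mul_div_cancel_right₀ _ ha0]
  have e2 : a / b = u⁻¹ := by rw [← e1, inv_div]
  have e3 : (1 - b) / (1 - a) = w := by rw [hB, mul_div_cancel_right₀ _ hA0]
  have e4 : (1 - a) / (1 - b) = w⁻¹ := by rw [← e3, inv_div]
  have i1 : 1 - a⁻¹ = -((1 - a) / a) := by field_simp; ring
  have i2 : 1 - b⁻¹ = -((1 - b) / b) := by field_simp; ring
  have e5 : (1 - b⁻¹) / (1 - a⁻¹) = w / u := by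
    rw [i1, i2, neg_div_neg_eq, div_div_div_eq, ← e1, ← e3, div_div_div_eq, mul_comm b]
  have e6 : (1 - a⁻¹) / (1 - b⁻¹) = u / w := by rw [← inv_div, e5, inv_div]
  have h1 := symb2_fiveTerm D ha0 ha1 hb0 hb1 hab
  have h2 := symb2_fiveTerm D hb0 hb1 ha0 ha1 (Ne.symm hab)
  rw [e1, e3, e5] at h1
  rw [e2, e4, e6] at h2
  rw [← add_zero (0 : Beta2 D)]
  nth_rewrite 1 [← h1]
  rw [← h2]
  abel

lemma symb2_inv_of [NeZero (2 : F)] (D : Derivation ℤ F F) {t u : F} (ht0 : t ≠ 0) (ht1 : t ≠ 1)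
    (hu0 : u ≠ 0) (hu1 : u ≠ 1) (hut : u * t ≠ 1) : symb2 D t⁻¹ = -symb2 D t := by
  have hw0 : u * t ≠ 0 := mul_ne_zero hu0 ht0
  have huw : u ≠ u * t := fun h => ht1 (mul_left_cancel₀ hu0 (by rw [mul_one, ← h]))
  have h1 := symb2_inv_aux D hu0 hu1 hw0 hut huw
  have h2 := symb2_inv_aux D hw0 hut hu0 hu1 (Ne.symm huw)
  have e1 : u * t / u = t := mul_div_cancel_left₀ _ hu0
  have e2 : u / (u * t) = t⁻¹ := by rw [← inv_div, e1]
  rw [e1, e2] at h1 h2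
  have h3 : (2 : F) • (symb2 D t⁻¹ + symb2 D t) = 0 := by
    rw [two_smul, ← add_zero (0 : Beta2 D)]
    nth_rewrite 1 [← h1]
    rw [← h2]
    abel
  rw [smul_eq_zero] at h3
  exact eq_neg_of_add_eq_zero_left (h3.resolve_left (NeZero.ne _))

/-- If `F ∖ {0, 1}` has two elements, then the inversion relation holds. -/
lemma symb2_inv [NeZero (2 : F)] (D : Derivation ℤ F F) {t a b : F} (ht0 : t ≠ 0) (ht1 : t ≠ 1)
    (ha0 : a ≠ 0) (ha1 : a ≠ 1) (hb0 : b ≠ 0) (hb1 : b ≠ 1) (hab : a ≠ b) :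
    symb2 D t⁻¹ = -symb2 D t := by
  by_cases h : a * t = 1
  · refine symb2_inv_of D ht0 ht1 hb0 hb1 fun h' => hab ?_
    exact mul_right_cancel₀ ht0 (h.trans h'.symm)
  · exact symb2_inv_of D ht0 ht1 ha0 ha1 h

lemma succAbove_five (i : Fin 5) (k : Fin 4) : i.succAbove k =
    (![![1, 2, 3, 4], ![0, 2, 3, 4], ![0, 1, 3, 4], ![0, 1, 2, 4], ![0, 1, 2, 3]] :
      Fin 5 → Fin 4 → Fin 5) i k := by
  revert i k; decide

/-- The five-term relation of the cross-ratio in `β₂ᴰ(F)`. -/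
lemma symb2_crossRatio [NeZero (2 : F)] (D : Derivation ℤ F F) (p : Fin 5 → Fin 2 → F)
    (hp : ∀ i j, i ≠ j → det2 (p i) (p j) ≠ 0) :
    ∑ i : Fin 5, (-1 : ℤ) ^ (i : ℕ) • symb2 D (crossRatio fun k => p (i.succAbove k)) = 0 := by
  have hr : ∀ i : Fin 5, _ := fun i => crossRatio_ne (p := fun k => p (i.succAbove k))
    (fun a b hab => hp _ _ (fun h => hab (Fin.succAbove_right_injective h)))
  obtain ⟨a, ha⟩ : ∃ a, a = crossRatio fun k => p ((4 : Fin 5).succAbove k) := ⟨_, rfl⟩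
  obtain ⟨b, hb⟩ : ∃ b, b = crossRatio fun k => p ((3 : Fin 5).succAbove k) := ⟨_, rfl⟩
  obtain ⟨ha0, ha1, hA⟩ := hr 4
  obtain ⟨hb0, hb1, hB⟩ := hr 3
  obtain ⟨hz0, hz1, -⟩ := hr 1
  obtain ⟨hw0, hw1, -⟩ := hr 0
  obtain ⟨-, hq1, -⟩ := hr 2
  rw [← ha] at ha0 ha1 hA
  rw [← hb] at hb0 hb1 hB
  have d01 := hp 0 1 (by decide)
  have d02 := hp 0 2 (by decide)
  have d03 := hp 0 3 (by decide)
  have d04 := hp 0 4 (by decide)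
  have d12 := hp 1 2 (by decide)
  have d13 := hp 1 3 (by decide)
  have d14 := hp 1 4 (by decide)
  have d23 := hp 2 3 (by decide)
  have d24 := hp 2 4 (by decide)
  have d34 := hp 3 4 (by decide)
  have e2 : (crossRatio fun k => p ((2 : Fin 5).succAbove k)) = b / a := by
    rw [ha, hb]
    simp only [crossRatio, succAbove_five, Matrix.cons_val]
    field_simp
  have e0 : (crossRatio fun k => p ((0 : Fin 5).succAbove k))⁻¹ = (1 - b) / (1 - a) := by
    rw [hA, hB]
    simp only [crossRatio, succAbove_five, Matrix.cons_val]
    field_simp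
  have e1 : (crossRatio fun k => p ((1 : Fin 5).succAbove k))⁻¹ = (1 - b⁻¹) / (1 - a⁻¹) := by
    have i1 : 1 - a⁻¹ = -((1 - a) / a) := by field_simp; ring
    have i2 : 1 - b⁻¹ = -((1 - b) / b) := by field_simp; ring
    rw [i1, i2, neg_div_neg_eq, hA, hB, ha, hb]
    simp only [crossRatio, succAbove_five, Matrix.cons_val]
    field_simp
  have hab : a ≠ b := fun h => hq1 (by rw [e2, h, div_self hb0])
  have h5 := symb2_fiveTerm D ha0 ha1 hb0 hb1 hab
  rw [← e2, ← e0, ← e1, symb2_inv D hw0 hw1 ha0 ha1 hb0 hb1 hab,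
    symb2_inv D hz0 hz1 ha0 ha1 hb0 hb1 hab, ha, hb] at h5
  rw [Fin.sum_univ_five, ← h5]
  norm_num
  abel

/-- The five-term relation of the cross-ratio in `B₂(F)`. -/
lemma symbB2_crossRatio (p : Fin 5 → Fin 2 → F)
    (hp : ∀ i j, i ≠ j → det2 (p i) (p j) ≠ 0) :
    ∑ i : Fin 5, (-1 : ℤ) ^ (i : ℕ) • symbB2 (crossRatio fun k => p (i.succAbove k)) = 0 := by
  have h : QuotientAddGroup.mk' (R2 F) (∑ i : Fin 5, (-1 : ℤ) ^ (i : ℕ) •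
      intSymb (crossRatio fun k => p (i.succAbove k))) = 0 := by
    rw [← AddMonoidHom.mem_ker, QuotientAddGroup.ker_mk']
    exact AddSubgroup.subset_closure ⟨p, hp, rfl⟩
  simp only [map_sum, map_zsmul] at h
  exact h

end Symbols

/-! ## The Grassmannian complex -/

section Grassmannian

variable {F : Type*} [Field F] {V : Type*} [AddCommGroup V] [Module F V]

/-- The `m`-tuples of vectors in generic position in a three-dimensional space: any three or fewer
of them are linearly independent. -/
abbrev Generic (F : Type*) [Field F] (V : Type*) [AddCommGroup V] [Module F V] (m : ℕ) :
    Type _ :=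
  {l : Fin m → V // ∀ s : Finset (Fin m), s.card ≤ 3 → LinearIndepOn F l (s : Set (Fin m))}

/-- The diagonal action of `GL(V)` on tuples in generic position. -/
instance genericAction (m : ℕ) : MulAction (V ≃ₗ[F] V) (Generic F V m) where
  smul g l := ⟨fun i => g (l.1 i), fun s hs =>
    (l.2 s hs).map_injOn g.toLinearMap g.injective.injOn⟩
  one_smul _ := rfl
  mul_smul _ _ _ := rfl

lemma smul_val {m : ℕ} (g : V ≃ₗ[F] V) (l : Generic F V m) (i : Fin m) :
    (g • l).1 i = g (l.1 i) := rfl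

/-- Configurations: tuples in generic position modulo `GL(V)`. -/
abbrev Config (F : Type*) [Field F] (V : Type*) [AddCommGroup V] [Module F V] (m : ℕ) : Type _ :=
  MulAction.orbitRel.Quotient (V ≃ₗ[F] V) (Generic F V m)

/-- `C_m(3)`: the free abelian group generated by the configurations of `m` vectors. -/
abbrev Chain (F : Type*) [Field F] (V : Type*) [AddCommGroup V] [Module F V] (m : ℕ) : Type _ :=
  FreeAbelianGroup (Config F V m)

/-- The generator `(l_0, …, l_{m-1})` of `C_m(3)`. -/
def conf {m : ℕ} (l : Generic F V m) : Chain F V m :=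
  FreeAbelianGroup.of (Quotient.mk _ l)

/-- The additive map on `C_m(3)` defined by a `GL(V)`-invariant function on generic tuples. -/
def chainLift {m : ℕ} {A : Type*} [AddCommGroup A] (f : Generic F V m → A)
    (hf : ∀ (g : V ≃ₗ[F] V) (l : Generic F V m), f (g • l) = f l) : Chain F V m →+ A :=
  FreeAbelianGroup.lift (Quotient.lift f (by rintro _ l ⟨g, rfl⟩; exact hf g l))

lemma chainLift_conf {m : ℕ} {A : Type*} [AddCommGroup A] (f : Generic F V m → A)
    (hf : ∀ (g : V ≃ₗ[F] V) (l : Generic F V m), f (g • l) = f l) (l : Generic F V m) :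
    chainLift f hf (conf l) = f l := by
  simp [chainLift, conf]

/-- Omitting the `i`-th vector. -/
def face {m : ℕ} (i : Fin (m + 1)) (l : Generic F V (m + 1)) : Generic F V m :=
  ⟨fun k => l.1 (i.succAbove k), fun s hs => by
    refine LinearIndepOn.comp_of_image (f := i.succAbove) ?_
      Fin.succAbove_right_injective.injOn
    have := l.2 (s.map i.succAboveEmb) (by simpa using hs)
    simpa using this⟩

/-- The differential `(l_0, …, l_m) ↦ ∑ (-1)^i (l_0, …, l̂_i, …, l_m)`. -/
def grassD (F : Type*) [Field F] (V : Type*) [AddCommGroup V] [Module F V] (m : ℕ) :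
    Chain F V (m + 1) →+ Chain F V m :=
  chainLift (fun l => ∑ i : Fin (m + 1), (-1 : ℤ) ^ (i : ℕ) • conf (face i l)) fun g l => by
    refine Finset.sum_congr rfl fun i _ => ?_
    have h : (Quotient.mk _ (face i (g • l)) : Config F V m) = Quotient.mk _ (face i l) :=
      Quotient.sound (s := MulAction.orbitRel _ _) ⟨g, rfl⟩
    rw [conf, conf, h]

/-- Volume forms on `V`: nonzero alternating forms of degree three. -/
abbrev VolumeForm (F : Type*) [Field F] (V : Type*) [AddCommGroup V] [Module F V] : Type _ :=
  {ω : V [⋀^Fin 3]→ₗ[F] F // ω ≠ 0}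

/-- The determinant `Δ(x, y, z) = ⟨ω, x ∧ y ∧ z⟩`. -/
def vol (ω : VolumeForm F V) (x y z : V) : F := ω.1 ![x, y, z]

/-- The projected cross-ratio `r(x | y_0, y_1, y_2, y_3)`. -/
def projRatio (ω : VolumeForm F V) (x : V) (y : Fin 4 → V) : F :=
  (vol ω x (y 0) (y 3) * vol ω x (y 1) (y 2)) / (vol ω x (y 0) (y 2) * vol ω x (y 1) (y 3))

/-- The triple-ratio of six vectors. -/
def tripleRatio (ω : VolumeForm F V) (l : Fin 6 → V) : F :=
  (vol ω (l 0) (l 1) (l 3) * vol ω (l 1) (l 2) (l 4) * vol ω (l 2) (l 0) (l 5)) /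
    (vol ω (l 0) (l 1) (l 4) * vol ω (l 1) (l 2) (l 5) * vol ω (l 2) (l 0) (l 3))

/-- The determinant of the three vectors left from `l_0, …, l_3` after omitting `l_i`. -/
def omitVol (ω : VolumeForm F V) (l : Fin 4 → V) (i : Fin 4) : F :=
  vol ω (l (i.succAbove 0)) (l (i.succAbove 1)) (l (i.succAbove 2))

/-- The product over `j ≠ i` of the determinants of the three vectors left from `l_0, …, l_4` after
omitting `l_i` and `l_j`. -/
def omitProd (ω : VolumeForm F V) (l : Fin 5 → V) (i : Fin 5) : F :=
  ∏ k : Fin 4, omitVol ω (fun a => l (i.succAbove a)) k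

/-- The value of `τ₀` on `(l_0, …, l_3)`; the indices are taken modulo `4`. -/
def tau0Val (D : Derivation ℤ F F) (ω : VolumeForm F V) (l : Fin 4 → V) : F ⊗[ℤ] Wedge2 F :=
  ∑ i : Fin 4, (-1 : ℤ) ^ (i : ℕ) • (dlog D (omitVol ω l i) ⊗ₜ[ℤ]
    wedge (unitOf (omitVol ω l (i + 1) / omitVol ω l (i + 2)))
      (unitOf (omitVol ω l (i + 3) / omitVol ω l (i + 2))))

/-- The value of `τ₁` on `(l_0, …, l_4)`. -/
def tau1Val (D : Derivation ℤ F F) (ω : VolumeForm F V) (l : Fin 5 → V) : Mid D :=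
  (-(1 / 3) : F) • ∑ i : Fin 5, (-1 : ℤ) ^ (i : ℕ) •
    ((symb2 D (projRatio ω (l i) fun k => l (i.succAbove k)) ⊗ₜ[ℤ] unitOf (omitProd ω l i),
      dlog D (omitProd ω l i) ⊗ₜ[ℤ] symbB2 (projRatio ω (l i) fun k => l (i.succAbove k))) :
      Mid D)

/-- The value of `τ₂` on `(l_0, …, l_5)`: an alternating sum over the symmetric group. -/
def tau2Val (D : Derivation ℤ F F) (ω : VolumeForm F V) (l : Fin 6 → V) : Beta3 D :=
  (-(1 / 90) : F) • ∑ σ : Equiv.Perm (Fin 6), (Equiv.Perm.sign σ : ℤ) •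
    symb3 D (tripleRatio ω fun k => l (σ k))

/-! ### Invariance of the three maps under `GL(V)` -/

lemma vol_linearEquiv (ω : VolumeForm F V) [Fact (Module.finrank F V = 3)] (g : V ≃ₗ[F] V)  :
    ∃ c : F, c ≠ 0 ∧ ∀ x y z : V, vol ω (g x) (g y) (g z) = c * vol ω x y z := by
  have hV : Module.finrank F V = 3 := Fact.out
  have : Module.Finite F V := Module.finite_of_finrank_pos (by omega)
  let e : Module.Basis (Fin 3) F V := Module.finBasisOfFinrankEq F V hV
  refine ⟨LinearMap.det (g : V →ₗ[F] V), g.isUnit_det'.ne_zero, fun x y z => ?_⟩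
  have h : ![g x, g y, g z] = (g : V →ₗ[F] V) ∘ ![x, y, z] := by
    ext i; fin_cases i <;> rfl
  rw [vol, vol, h, ω.1.eq_smul_basis_det e, AlternatingMap.smul_apply, AlternatingMap.smul_apply,
    Module.Basis.det_comp, smul_eq_mul, smul_eq_mul]
  ring

/-- A volume form in coordinates. -/
lemma vol_coord (ω : VolumeForm F V) [Fact (Module.finrank F V = 3)] :
    ∃ (c : F) (f : V → Fin 3 → F), ∀ x y z : V, vol ω x y z =
      c * (f x 0 * f y 1 * f z 2 - f x 0 * f z 1 * f y 2 - f y 0 * f x 1 * f z 2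
        + f y 0 * f z 1 * f x 2 + f z 0 * f x 1 * f y 2 - f z 0 * f y 1 * f x 2) := by
  have hV : Module.finrank F V = 3 := Fact.out
  have : Module.Finite F V := Module.finite_of_finrank_pos (by omega)
  let e : Module.Basis (Fin 3) F V := Module.finBasisOfFinrankEq F V hV
  refine ⟨ω.1 e, fun x => e.repr x, fun x y z => ?_⟩
  rw [vol, ω.1.eq_smul_basis_det e, AlternatingMap.smul_apply, smul_eq_mul,
    Module.Basis.det_apply, Matrix.det_fin_three]
  simp only [AlternatingMap.smul_apply, Module.Basis.det_self, smul_eq_mul, mul_one,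
    Module.Basis.toMatrix_apply, Matrix.cons_val]

lemma vol_ne_zero (ω : VolumeForm F V) [Fact (Module.finrank F V = 3)] {m : ℕ}
    (l : Generic F V m) {i j k : Fin m} (hij : i ≠ j) (hik : i ≠ k) (hjk : j ≠ k) :
    vol ω (l.1 i) (l.1 j) (l.1 k) ≠ 0 := by
  have hV : Module.finrank F V = 3 := Fact.out
  have : Module.Finite F V := Module.finite_of_finrank_pos (by omega)
  have hinj : Function.Injective ![i, j, k] := by
    intro a b
    fin_cases a <;> fin_cases b <;> simp [hij, hik, hjk, hij.symm, hik.symm, hjk.symm]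
  have h1 := l.2 {i, j, k} Finset.card_le_three
  have h2 : LinearIndependent F ![l.1 i, l.1 j, l.1 k] := by
    have h3 := LinearIndependent.comp h1
      (fun a : Fin 3 => ⟨![i, j, k] a, by fin_cases a <;> simp⟩)
      (fun a b hab => hinj (congrArg Subtype.val hab))
    convert h3 using 1
    ext a
    fin_cases a <;> rfl
  have h4 := (AlternatingMap.map_basis_ne_zero_iff
    (basisOfLinearIndependentOfCardEqFinrank h2 (by simp [hV])) ω.1).mpr ω.2
  rwa [coe_basisOfLinearIndependentOfCardEqFinrank] at h4

lemma det2_swap (u v : Fin 2 → F) : det2 u v = -det2 v u := by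
  simp only [det2]; ring

/-- Five vectors in generic position in a three-dimensional space have a dual configuration of
five points of the projective line with the same cross-ratios. -/
lemma exists_dual (ω : VolumeForm F V) [Fact (Module.finrank F V = 3)] (l : Generic F V 5) :
    ∃ p : Fin 5 → Fin 2 → F, (∀ i j, i ≠ j → det2 (p i) (p j) ≠ 0) ∧
      ∀ i : Fin 5, projRatio ω (l.1 i) (fun k => l.1 (i.succAbove k)) =
        crossRatio fun k => p (i.succAbove k) := by
  obtain ⟨c, f, hf⟩ := vol_coord ω
  have sw1 : ∀ x y z, vol ω y x z = -vol ω x y z := fun x y z => by rw [hf, hf]; ring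
  have sw2 : ∀ x y z, vol ω x z y = -vol ω x y z := fun x y z => by rw [hf, hf]; ring
  obtain ⟨v, hv⟩ : ∃ v : Fin 5 → Fin 5 → Fin 5 → F, 
      ∀ i j k, v i j k = vol ω (l.1 i) (l.1 j) (l.1 k) := ⟨_, fun _ _ _ => rfl⟩
  have nz : ∀ i j k, i ≠ j → i ≠ k → j ≠ k → v i j k ≠ 0 := fun i j k h1 h2 h3 => by
    rw [hv]; exact vol_ne_zero ω l h1 h2 h3
  have n012 := nz 0 1 2 (by decide) (by decide) (by decide)
  have n013 := nz 0 1 3 (by decide) (by decide) (by decide)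
  have n014 := nz 0 1 4 (by decide) (by decide) (by decide)
  have n023 := nz 0 2 3 (by decide) (by decide) (by decide)
  have n024 := nz 0 2 4 (by decide) (by decide) (by decide)
  have n034 := nz 0 3 4 (by decide) (by decide) (by decide)
  have n123 := nz 1 2 3 (by decide) (by decide) (by decide)
  have n124 := nz 1 2 4 (by decide) (by decide) (by decide)
  have n134 := nz 1 3 4 (by decide) (by decide) (by decide)
  have n234 := nz 2 3 4 (by decide) (by decide) (by decide)
  obtain ⟨p, hp⟩ : ∃ p : Fin 5 → Fin 2 → F, p = ![![v 1 2 3, v 1 2 4], ![-v 0 2 3, -v 0 2 4],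
    ![v 0 1 3, v 0 1 4], ![-v 0 1 2, 0], ![0, -v 0 1 2]] := ⟨_, rfl⟩
  have d34 : det2 (p 3) (p 4) = v 0 1 2 * v 0 1 2 := by simp [hp, det2]
  have d03 : det2 (p 0) (p 3) = v 0 1 2 * v 1 2 4 := by simp [hp, det2]; ring
  have d04 : det2 (p 0) (p 4) = -(v 0 1 2 * v 1 2 3) := by simp [hp, det2]; ring
  have d13 : det2 (p 1) (p 3) = -(v 0 1 2 * v 0 2 4) := by simp [hp, det2]; ring
  have d14 : det2 (p 1) (p 4) = v 0 1 2 * v 0 2 3 := by simp [hp, det2]; ring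
  have d23 : det2 (p 2) (p 3) = v 0 1 2 * v 0 1 4 := by simp [hp, det2]; ring
  have d24 : det2 (p 2) (p 4) = -(v 0 1 2 * v 0 1 3) := by simp [hp, det2]; ring
  have d01 : det2 (p 0) (p 1) = v 0 1 2 * v 2 3 4 := by
    simp [hp, det2, hv, hf]; ring
  have d02 : det2 (p 0) (p 2) = -(v 0 1 2 * v 1 3 4) := by
    simp [hp, det2, hv, hf]; ring
  have d12 : det2 (p 1) (p 2) = v 0 1 2 * v 0 3 4 := by
    simp [hp, det2, hv, hf]; ring
  refine ⟨p, ?_, ?_⟩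
  · have hlt : ∀ i j : Fin 5, i < j → det2 (p i) (p j) ≠ 0 := by
      clear hp hf hv sw1 sw2 nz
      intro i j hij
      fin_cases i <;> fin_cases j <;> first
        | exact absurd hij (by decide)
        | simp_all
    intro i j hij
    rcases lt_or_gt_of_ne hij with h | h
    · exact hlt i j h
    · rw [det2_swap]
      exact neg_ne_zero.mpr (hlt j i h)
  · have s1 : ∀ i j k, v j i k = -v i j k := fun i j k => by rw [hv, hv]; exact sw1 _ _ _
    have s2 : ∀ i j k, v i k j = -v i j k := fun i j k => by rw [hv, hv]; exact sw2 _ _ _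
    intro i
    simp only [projRatio, crossRatio, ← hv, succAbove_five]
    fin_cases i
    · simp only [Fin.zero_eta, Matrix.cons_val, d14, d23, d13, d24]
      field_simp
    · simp only [Fin.mk_one, Matrix.cons_val, d04, d23, d03, d24]
      rw [s1 0 1 4, s1 0 1 3]
      field_simp
    · simp only [Fin.reduceFinMk, Matrix.cons_val, d04, d13, d03, d14]
      rw [s1 0 2 4, s1 1 2 3, s1 0 2 3, s1 1 2 4]
      field_simp
    · simp only [Fin.reduceFinMk, Matrix.cons_val, d04, d12, d02, d14]
      rw [s1 0 3 4, s1 1 3 2, s1 0 3 2, s1 1 3 4, s2 1 2 3, s2 0 2 3]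
      field_simp
    · simp only [Fin.reduceFinMk, Matrix.cons_val, d03, d12, d02, d13]
      rw [s1 0 4 3, s1 1 4 2, s1 0 4 2, s1 1 4 3, s2 1 2 4, s2 0 2 4, s2 0 3 4, s2 1 3 4]
      field_simp

lemma symb2_projRatio [NeZero (2 : F)] (D : Derivation ℤ F F) (ω : VolumeForm F V)
    [Fact (Module.finrank F V = 3)] (l : Generic F V 5) :
    ∑ i : Fin 5, (-1 : ℤ) ^ (i : ℕ) •
      symb2 D (projRatio ω (l.1 i) fun k => l.1 (i.succAbove k)) = 0 := by
  obtain ⟨p, hp, h⟩ := exists_dual ω l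
  simp only [h]
  exact symb2_crossRatio D p hp

lemma symbB2_projRatio (ω : VolumeForm F V)
    [Fact (Module.finrank F V = 3)] (l : Generic F V 5) :
    ∑ i : Fin 5, (-1 : ℤ) ^ (i : ℕ) •
      symbB2 (projRatio ω (l.1 i) fun k => l.1 (i.succAbove k)) = 0 := by
  obtain ⟨p, hp, h⟩ := exists_dual ω l
  simp only [h]
  exact symbB2_crossRatio p hp

lemma omitVol_ne_zero (ω : VolumeForm F V) [Fact (Module.finrank F V = 3)]
    (l : Generic F V 4) (i : Fin 4) : omitVol ω l.1 i ≠ 0 :=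
  vol_ne_zero ω l (by revert i; decide) (by revert i; decide) (by revert i; decide)

lemma omitProd_ne_zero (ω : VolumeForm F V) [Fact (Module.finrank F V = 3)]
    (l : Generic F V 5) (i : Fin 5) : omitProd ω l.1 i ≠ 0 :=
  Finset.prod_ne_zero_iff.mpr fun k _ => omitVol_ne_zero ω (face i l) k

lemma tau0Val_smul (D : Derivation ℤ F F) (ω : VolumeForm F V) [Fact (Module.finrank F V = 3)]
    (g : V ≃ₗ[F] V) (l : Generic F V 4) : tau0Val D ω (g • l).1 = tau0Val D ω l.1 := by
  obtain ⟨c, hc, h⟩ := vol_linearEquiv ω g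
  have h1 : ∀ i, omitVol ω (g • l).1 i = c * omitVol ω l.1 i := fun i => h _ _ _
  have h0 := omitVol_ne_zero ω l
  simp only [tau0Val, h1, mul_div_mul_left _ _ hc, dlog_mul D hc (h0 _), unitOf_div (h0 _) (h0 _),
    Fin.sum_univ_four, ← wedgeBilin_apply, Fin.reduceAdd, zero_add]
  generalize unitOf (omitVol ω l.1 0) = a0
  generalize unitOf (omitVol ω l.1 1) = a1
  generalize unitOf (omitVol ω l.1 2) = a2
  generalize unitOf (omitVol ω l.1 3) = a3
  simp only [map_sub, LinearMap.sub_apply, wedgeBilin_self,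
    wedgeBilin_swap a2 a0, wedgeBilin_swap a3 a0, wedgeBilin_swap a3 a1, TensorProduct.add_tmul,
    TensorProduct.tmul_sub, TensorProduct.tmul_neg, TensorProduct.tmul_zero]
  norm_num
  abel

lemma tau1Val_smul [NeZero (2 : F)] (D : Derivation ℤ F F) (ω : VolumeForm F V)
    [Fact (Module.finrank F V = 3)]
    (g : V ≃ₗ[F] V) (l : Generic F V 5) : tau1Val D ω (g • l).1 = tau1Val D ω l.1 := by
  obtain ⟨c, hc, h⟩ := vol_linearEquiv ω g
  have h1 : ∀ i, omitProd ω (g • l).1 i = c ^ 4 * omitProd ω l.1 i := fun i => by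
    have h2 : ∀ k, omitVol ω (fun a => (g • l).1 (i.succAbove a)) k =
      c * omitVol ω (fun a => l.1 (i.succAbove a)) k := fun k => h _ _ _
    simp only [omitProd, h2, Finset.prod_mul_distrib, Finset.prod_const, Finset.card_univ,
      Fintype.card_fin]
  have h3 : ∀ i, projRatio ω ((g • l).1 i) (fun k => (g • l).1 (i.succAbove k)) =
      projRatio ω (l.1 i) (fun k => l.1 (i.succAbove k)) := fun i => by
    simp only [projRatio, smul_val, h, mul_mul_mul_comm c _ c]
    exact mul_div_mul_left _ _ (mul_ne_zero hc hc)
  have h0 := omitProd_ne_zero ω l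
  have hc4 : c ^ 4 ≠ 0 := pow_ne_zero _ hc
  have s1 := symb2_projRatio D ω l
  have s2 := symbB2_projRatio ω l
  have t1 := congrArg (fun z => z ⊗ₜ[ℤ] unitOf (c ^ 4)) s1
  have t2 := congrArg (fun z => dlog D (c ^ 4) ⊗ₜ[ℤ] z) s2
  simp only [TensorProduct.sum_tmul, TensorProduct.zero_tmul, ← TensorProduct.smul_tmul'] at t1
  simp only [TensorProduct.tmul_sum, TensorProduct.tmul_zero, TensorProduct.tmul_smul] at t2
  simp only [tau1Val, h1, h3, unitOf_mul hc4 (h0 _), dlog_mul D hc4 (h0 _)]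
  congr 1
  ext1
  · simp only [Prod.fst_sum, Prod.smul_fst, TensorProduct.tmul_add, smul_add,
      Finset.sum_add_distrib, t1, zero_add]
  · simp only [Prod.snd_sum, Prod.smul_snd, TensorProduct.add_tmul, smul_add,
      Finset.sum_add_distrib, t2, zero_add]

lemma tau2Val_smul (D : Derivation ℤ F F) (ω : VolumeForm F V) [Fact (Module.finrank F V = 3)]
    (g : V ≃ₗ[F] V) (l : Generic F V 6) : tau2Val D ω (g • l).1 = tau2Val D ω l.1 := by
  obtain ⟨c, hc, h⟩ := vol_linearEquiv ω g
  have h3 : ∀ σ : Equiv.Perm (Fin 6), tripleRatio ω (fun k => (g • l).1 (σ k)) =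
      tripleRatio ω (fun k => l.1 (σ k)) := fun σ => by
    simp only [tripleRatio, smul_val, h, mul_mul_mul_comm c _ c,
      mul_mul_mul_comm (c * c) _ c]
    exact mul_div_mul_left _ _ (mul_ne_zero (mul_ne_zero hc hc) hc)
  simp only [tau2Val, h3]

/-! ### The morphism -/

/-- `τ₀ : C_4(3) → F ⊗ ⋀² F^×`. -/
def tau0 (D : Derivation ℤ F F) (ω : VolumeForm F V) [Fact (Module.finrank F V = 3)] :
    Chain F V 4 →+ F ⊗[ℤ] Wedge2 F :=
  chainLift (fun l => tau0Val D ω l.1) (tau0Val_smul D ω)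

/-- `τ₁ : C_5(3) → (β₂ᴰ(F) ⊗ F^×) ⊕ (F ⊗ B₂(F))`. -/
def tau1 [NeZero (2 : F)] (D : Derivation ℤ F F) (ω : VolumeForm F V)
    [Fact (Module.finrank F V = 3)] : Chain F V 5 →+ Mid D :=
  chainLift (fun l => tau1Val D ω l.1) (tau1Val_smul D ω)

/-- `τ₂ : C_6(3) → β₃ᴰ(F)`. -/
def tau2 (D : Derivation ℤ F F) (ω : VolumeForm F V) [Fact (Module.finrank F V = 3)] :
    Chain F V 6 →+ Beta3 D :=
  chainLift (fun l => tau2Val D ω l.1) (tau2Val_smul D ω)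

end Grassmannian

end WeightThree

end

/-!
Both squares are checked after pairing formal logarithms of volumes, so that a determinant identity
becomes an identity between alternating sums over all orderings of the vectors. In such a sum a term
vanishes as soon as some permutation of the vectors changes it by the wrong sign, and terms that
differ by a relabelling of the vectors agree up to sign.

For the second square, the boundary of `τ₁` at five vectors is `1/6` of the alternating sum of
`D log Δ(0,1,2) ⊗ Δ(0,1,3) ∧ c`, summed cyclically over the three factors, where `c` is the product
of the four volumes of `l₁, …, l₄`. Only the factor `Δ(1,2,3)` of `c` survives, and it gives `τ₀`.

For the first square, a triple ratio is the cross-ratio of the projections from `l₀` of `l₁`, `l₂`,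
`l₃` and the point where the lines `l₁l₄` and `l₂l₅` meet. The five-term relation for these points
together with `l₄` turns an alternating sum of triple ratios into one of projected cross-ratios of
the six given vectors. Two further five-term relations, one for five vectors projected from the
sixth and one for the projections of five vectors from each of them, bring all of these to a single
sum, with total coefficient `30 = 90 / 3`.
-/

noncomputable section

namespace WeightThree

section Chains

variable {F : Type*} [Field F] {V : Type*} [AddCommGroup V] [Module F V] {A : Type*}
  [AddCommGroup A]

lemma chain_hom_ext {m : ℕ} {f g : Chain F V m →+ A}
    (h : ∀ l : Generic F V m, f (conf l) = g (conf l)) : f = g := by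
  refine FreeAbelianGroup.lift_ext _ _ fun q => ?_
  induction q using Quotient.inductionOn with
  | h l => exact h l

lemma map_grassD_conf {m : ℕ} (f : Chain F V m →+ A) (l : Generic F V (m + 1)) :
    f (grassD F V m (conf l)) =
      ∑ i : Fin (m + 1), (-1 : ℤ) ^ (i : ℕ) • f (conf (face i l)) := by
  simp only [grassD, chainLift_conf, map_sum, map_zsmul]

lemma face_predAbove_face_succAbove {m : ℕ} (l : Generic F V (m + 2)) (i : Fin (m + 2))
    (j : Fin (m + 1)) : face (j.predAbove i) (face (i.succAbove j) l) = face j (face i l) :=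
  Subtype.ext <| funext fun k =>
    congrArg l.1 (Fin.succAbove_succAbove_succAbove_predAbove i j k)

theorem grassD_comp_grassD (m : ℕ) : (grassD F V m).comp (grassD F V (m + 1)) = 0 := by
  refine chain_hom_ext fun l => ?_
  have h (i : Fin (m + 2)) : grassD F V m (conf (face i l)) =
      ∑ j : Fin (m + 1), (-1 : ℤ) ^ (j : ℕ) • conf (face j (face i l)) :=
    map_grassD_conf (AddMonoidHom.id _) _
  simp only [AddMonoidHom.comp_apply, map_grassD_conf, h, Finset.smul_sum, smul_smul, ← pow_add,
    AddMonoidHom.zero_apply, ← Fintype.sum_prod_type']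
  -- The two ways of omitting the vectors `i` and `i.succAbove j` come with opposite signs.
  refine Finset.sum_involution (fun p _ => (p.1.succAbove p.2, p.2.predAbove p.1)) ?_ ?_
    (fun _ _ => Finset.mem_univ _) ?_
  · rintro ⟨i, j⟩ -
    simp only [face_predAbove_face_succAbove, Fin.neg_one_pow_succAbove_add_predAbove, neg_smul,
      add_neg_cancel]
  · rintro ⟨i, j⟩ - - h
    exact Fin.succAbove_ne i j (congrArg Prod.fst h)
  · rintro ⟨i, j⟩ -
    simp only [Fin.succAbove_succAbove_predAbove, Fin.predAbove_predAbove_succAbove]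

end Chains

lemma bdryMid_comp_bdry3 {F : Type*} [Field F] [NeZero (2 : F)] (D : Derivation ℤ F F) :
    bdryMid D ∘ₗ bdry3 D = 0 := by
  have h : bdryMid D ∘ₗ bdry3Pre D = 0 := by
    refine Finsupp.lhom_ext fun a b => ?_
    have h : wedge (unitOf a.1) (unitOf a.1) = 0 := wedgeBilin_self _
    simp only [LinearMap.comp_apply, bdry3Pre, Finsupp.linearCombination_single, map_smul,
      bdryMid_apply D _ _ a.2.1 a.2.2 a.2.1 a.2.2, LinearMap.zero_apply, h,
      TensorProduct.tmul_zero, zero_sub, neg_add_cancel, smul_zero]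
  refine LinearMap.ext fun z => ?_
  obtain ⟨z, rfl⟩ := Submodule.Quotient.mk_surjective _ z
  exact LinearMap.congr_fun h z

lemma eq_zero_of_eq_neg (F : Type*) [Field F] [NeZero (2 : F)] {N : Type*} [AddCommGroup N]
    [Module F N] {n : N} (h : n = -n) : n = 0 := by
  rw [eq_neg_iff_add_eq_zero, ← two_smul F, smul_eq_zero] at h
  exact h.resolve_left (NeZero.ne 2)

section Logarithms

variable {F : Type*} [Field F]

/-- The multiplicative group with scalars extended to `F`. All maps of the infinitesimal complex
that are additive in an element of `F^×` factor through it, and it does not see signs. -/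
abbrev LogSpace (F : Type*) [Field F] : Type _ := F ⊗[ℤ] MulGroup F

/-- The formal logarithm `1 ⊗ x` of `x`; it is `0` at `x = 0`. -/
def logOf (x : F) : LogSpace F := 1 ⊗ₜ[ℤ] unitOf x

lemma logOf_mul {x y : F} (hx : x ≠ 0) (hy : y ≠ 0) : logOf (x * y) = logOf x + logOf y := by
  rw [logOf, unitOf_mul hx hy, TensorProduct.tmul_add, logOf, logOf]

lemma logOf_div {x y : F} (hx : x ≠ 0) (hy : y ≠ 0) : logOf (x / y) = logOf x - logOf y := by
  rw [logOf, unitOf_div hx hy, TensorProduct.tmul_sub, logOf, logOf]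

lemma logOf_one : logOf (1 : F) = 0 := by
  simpa using logOf_div (one_ne_zero (α := F)) one_ne_zero

lemma logOf_prod {ι : Type*} (s : Finset ι) {g : ι → F} (hg : ∀ i ∈ s, g i ≠ 0) :
    logOf (∏ i ∈ s, g i) = ∑ i ∈ s, logOf (g i) := by
  classical
  induction s using Finset.induction_on with
  | empty => exact logOf_one
  | insert i s hi ih =>
    have hs : ∀ j ∈ s, g j ≠ 0 := fun j hj => hg j (Finset.mem_insert_of_mem hj)
    rw [Finset.prod_insert hi, Finset.sum_insert hi, logOf_mul (hg i (Finset.mem_insert_self i s))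
      (Finset.prod_ne_zero_iff.mpr hs), ih hs]

lemma logOf_neg [NeZero (2 : F)] (x : F) : logOf (-x) = logOf x := by
  rcases eq_or_ne x 0 with rfl | hx
  · rw [neg_zero]
  · exact tmul_unitOf_neg 1 hx

/-- The logarithmic derivative as a linear form on formal logarithms. -/
def dlogMap (D : Derivation ℤ F F) : LogSpace F →ₗ[F] F :=
  LinearMap.liftBaseChange F <| AddMonoidHom.toIntLinearMap
    { toFun := fun u => dlog D (u.toMul : F)
      map_zero' := by simp [dlog]
      map_add' := fun u v => dlog_mul D u.toMul.ne_zero v.toMul.ne_zero }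

lemma dlogMap_logOf (D : Derivation ℤ F F) (x : F) : dlogMap D (logOf x) = dlog D x := by
  rcases eq_or_ne x 0 with rfl | hx
  · simp [logOf, unitOf, dlog]
  · simp [logOf, unitOf, dlogMap, hx]

/-- The `F`-bilinear extension of the wedge product of `F^×`. -/
def logWedge (F : Type*) [Field F] : LogSpace F →ₗ[F] LogSpace F →ₗ[F] F ⊗[ℤ] Wedge2 F :=
  LinearMap.BilinMap.baseChange F (wedgeBilin F)

lemma logWedge_logOf (x y : F) :
    logWedge F (logOf x) (logOf y) = 1 ⊗ₜ[ℤ] wedge (unitOf x) (unitOf y) := by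
  rw [logWedge, logOf, logOf, LinearMap.BilinMap.baseChange_tmul, mul_one, wedgeBilin_apply]

lemma logWedge_swap (x y : LogSpace F) : logWedge F x y = -logWedge F y x := by
  induction x using TensorProduct.induction_on with
  | zero => simp
  | add x x' hx hx' => rw [map_add, LinearMap.add_apply, hx, hx', map_add, neg_add]
  | tmul a u =>
    induction y using TensorProduct.induction_on with
    | zero => simp
    | add y y' hy hy' => rw [map_add, hy, hy', map_add, LinearMap.add_apply, neg_add]
    | tmul b v =>
      simp only [logWedge, LinearMap.BilinMap.baseChange_tmul]
      rw [mul_comm, wedgeBilin_swap u v, TensorProduct.tmul_neg]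

lemma logWedge_self [NeZero (2 : F)] (x : LogSpace F) : logWedge F x x = 0 :=
  eq_zero_of_eq_neg F (logWedge_swap x x)

/-- The alternating trilinear map `dlog ∧ (· ∧ ·)` on formal logarithms. It is the common shape of
the map `τ₀` and of the second differential of the infinitesimal complex. -/
def cyclicWedge (D : Derivation ℤ F F) (x y z : LogSpace F) : F ⊗[ℤ] Wedge2 F :=
  dlogMap D x • logWedge F y z + dlogMap D y • logWedge F z x + dlogMap D z • logWedge F x y

variable (D : Derivation ℤ F F) (x y z : LogSpace F)

lemma cyclicWedge_rotate : cyclicWedge D x y z = cyclicWedge D y z x := by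
  simp only [cyclicWedge]
  abel

lemma cyclicWedge_swap : cyclicWedge D y x z = -cyclicWedge D x y z := by
  simp only [cyclicWedge, logWedge_swap x z, logWedge_swap z y, logWedge_swap y x, smul_neg]
  abel

lemma cyclicWedge_swap_right : cyclicWedge D x z y = -cyclicWedge D x y z := by
  rw [cyclicWedge_rotate, cyclicWedge_swap, ← cyclicWedge_rotate]

lemma cyclicWedge_reverse : cyclicWedge D z y x = -cyclicWedge D x y z := by
  rw [cyclicWedge_rotate, cyclicWedge_swap]

lemma cyclicWedge_add_right (z' : LogSpace F) :
    cyclicWedge D x y (z + z') = cyclicWedge D x y z + cyclicWedge D x y z' := by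
  simp only [cyclicWedge, map_add, LinearMap.add_apply, smul_add, add_smul]
  abel

lemma cyclicWedge_add_middle (y' : LogSpace F) :
    cyclicWedge D x (y + y') z = cyclicWedge D x y z + cyclicWedge D x y' z := by
  simp only [← cyclicWedge_rotate D z x, cyclicWedge_add_right]

lemma cyclicWedge_add_left (x' : LogSpace F) :
    cyclicWedge D (x + x') y z = cyclicWedge D x y z + cyclicWedge D x' y z := by
  simp only [cyclicWedge_rotate D _ y, cyclicWedge_add_right]

lemma cyclicWedge_sub_sub [NeZero (2 : F)] (t : LogSpace F) :
    cyclicWedge D (x - t) (y - t) z =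
      cyclicWedge D x y z + cyclicWedge D y t z + cyclicWedge D t x z := by
  simp only [cyclicWedge, map_sub, LinearMap.sub_apply, logWedge_self, logWedge_swap t x,
    logWedge_swap y t, logWedge_swap y z, logWedge_swap t z, logWedge_swap z x, smul_sub, sub_smul,
    smul_neg]
  abel

/-- The term `β₂ᴰ(F) × (F ⊗ B₂(F))` receiving both kinds of dilogarithm classes. -/
abbrev DilogSpace (D : Derivation ℤ F F) : Type _ := Beta2 D × (F ⊗[ℤ] B2 F)

/-- The pair of the two dilogarithm classes of `x`. -/
def dilogOf (D : Derivation ℤ F F) (x : F) : DilogSpace D := (symb2 D x, 1 ⊗ₜ[ℤ] symbB2 x)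

/-- The product of dilogarithms and logarithms with values in the middle term of the infinitesimal
complex. -/
def midPairing (D : Derivation ℤ F F) : LogSpace F →ₗ[F] DilogSpace D →ₗ[F] Mid D :=
  LinearMap.mk₂ F (fun u m =>
      (TensorProduct.AlgebraTensorModule.cancelBaseChange ℤ F F (Beta2 D) (MulGroup F)
        (m.1 ⊗ₜ[F] u), dlogMap D u • m.2))
    (fun u v m => by simp [TensorProduct.tmul_add, add_smul])
    (fun c u m => by simp [mul_smul])
    (fun u m n => by simp [TensorProduct.add_tmul])
    (fun c u m => by
      rw [Prod.smul_fst, Prod.smul_snd, ← TensorProduct.smul_tmul', map_smul, smul_comm,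
        Prod.smul_mk])

lemma midPairing_logOf_dilogOf (x y : F) : midPairing D (logOf x) (dilogOf D y) =
    (symb2 D y ⊗ₜ[ℤ] unitOf x, dlog D x ⊗ₜ[ℤ] symbB2 y) := by
  simp [midPairing, logOf, dilogOf, ← dlogMap_logOf, TensorProduct.smul_tmul']

end Logarithms

section AlternatingSums

variable {X N : Type*} [AddCommGroup N] {n : ℕ}

/-- The alternating sum of a function of `n` points over all permutations of `l`. -/
def altSum (l : Fin n → X) : ((Fin n → X) → N) →+ N where
  toFun G := ∑ σ : Equiv.Perm (Fin n), (Equiv.Perm.sign σ : ℤ) • G (l ∘ σ)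
  map_zero' := by simp
  map_add' G H := by simp [Finset.sum_add_distrib]

lemma altSum_apply (l : Fin n → X) (G : (Fin n → X) → N) :
    altSum l G = ∑ σ : Equiv.Perm (Fin n), (Equiv.Perm.sign σ : ℤ) • G (l ∘ σ) := rfl

lemma altSum_add (l : Fin n → X) (G H : (Fin n → X) → N) :
    altSum l (fun y => G y + H y) = altSum l G + altSum l H :=
  map_add (altSum l) G H

lemma altSum_zsmul (l : Fin n → X) (k : ℤ) (G : (Fin n → X) → N) :
    altSum l (fun y => k • G y) = k • altSum l G :=
  map_zsmul (altSum l) k G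

lemma altSum_comp_perm (l : Fin n → X) (π : Equiv.Perm (Fin n)) (G : (Fin n → X) → N) :
    altSum l (fun y => G (y ∘ π)) = (Equiv.Perm.sign π : ℤ) • altSum l G := by
  rw [altSum_apply, altSum_apply, ← Equiv.sum_comp (Equiv.mulRight π⁻¹), Finset.smul_sum]
  refine Finset.sum_congr rfl fun σ _ => ?_
  rw [Equiv.coe_mulRight, map_mul, Equiv.Perm.sign_inv, Units.val_mul, smul_smul, mul_comm]
  congr 2
  ext k
  simp

lemma altSum_succ (l : Fin (n + 1) → X) (G : (Fin (n + 1) → X) → N) :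
    altSum l G = ∑ i : Fin (n + 1), (-1 : ℤ) ^ (i : ℕ) •
      altSum (i.removeNth l) fun y => G (Fin.cons (l i) y) := by
  let e (p : Fin (n + 1) × Equiv.Perm (Fin n)) : Equiv.Perm (Fin (n + 1)) :=
    p.1.cycleRange.symm * Equiv.Perm.decomposeFin.symm (0, p.2)
  have e_zero (p) : e p 0 = p.1 := by simp [e]
  have e_succ (p) (k : Fin n) : e p k.succ = p.1.succAbove (p.2 k) := by simp [e]
  have e_bijective : Function.Bijective e := by
    refine (Fintype.bijective_iff_injective_and_card e).mpr ⟨fun p q h => ?_, ?_⟩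
    · have h0 : p.1 = q.1 := by rw [← e_zero, h, e_zero]
      refine Prod.ext h0 (Equiv.ext fun k => p.1.succAbove_right_injective ?_)
      rw [← e_succ, h, e_succ, h0]
    · simp [Fintype.card_perm, Nat.factorial_succ]
  simp only [altSum_apply]
  rw [← e_bijective.sum_comp, Fintype.sum_prod_type]
  refine Finset.sum_congr rfl fun i _ => ?_
  rw [Finset.smul_sum]
  refine Finset.sum_congr rfl fun τ _ => ?_
  have hsign : ((Equiv.Perm.sign (e (i, τ)) : ℤˣ) : ℤ) = (-1) ^ (i : ℕ) * Equiv.Perm.sign τ := by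
    simp [e, Fin.sign_cycleRange, Equiv.Perm.decomposeFin.symm_sign]
  have hcons : l ∘ e (i, τ) = Fin.cons (l i) (i.removeNth l ∘ τ) := by
    ext k
    cases k using Fin.cases <;> simp [e_zero, e_succ, Fin.removeNth]
  rw [hsign, hcons, mul_smul]

lemma altSum_three (l : Fin 3 → X) (G : X → X → X → N) :
    altSum l (fun y => G (y 0) (y 1) (y 2)) =
      G (l 0) (l 1) (l 2) - G (l 0) (l 2) (l 1) - G (l 1) (l 0) (l 2) + G (l 1) (l 2) (l 0)
        + G (l 2) (l 0) (l 1) - G (l 2) (l 1) (l 0) := by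
  simp only [Fin.isValue, altSum_succ, Nat.reduceAdd, Fin.cons_zero, Fin.cons_one, Fin.removeNth,
    Fin.succAbove, Finset.univ_unique, Fin.default_eq_zero, Fin.val_eq_zero, pow_zero,
    altSum_apply (n := 0), Equiv.Perm.default_eq, Finset.sum_singleton, Equiv.Perm.sign_one,
    Units.val_one, Equiv.Perm.coe_one, CompTriple.comp_eq, one_smul, Fin.castSucc_zero,
    Fin.succ_zero_eq_one, Fin.removeNth_zero, Fin.sum_univ_succ, Fin.coe_ofNat_eq_mod,
    Nat.zero_mod, lt_self_iff_false, ↓reduceIte, Fin.castSucc_one, Fin.succ_one_eq_two,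
    Fin.val_succ, zero_add, pow_one, Fin.castSucc_succ, Fin.succ_pos, neg_smul,
    Finset.sum_neg_distrib, smul_add, smul_neg, not_lt_zero, neg_neg, even_two, Even.neg_pow,
    one_pow, Fin.reduceLT]
  abel

lemma sum_perm_apply_zero (g : Fin (n + 1) → N) :
    ∑ σ : Equiv.Perm (Fin (n + 1)), g (σ 0) = n.factorial • ∑ i, g i := by
  rw [← Equiv.sum_comp Equiv.Perm.decomposeFin.symm, Fintype.sum_prod_type, Finset.smul_sum]
  simp [Fintype.card_perm]

end AlternatingSums

section FiveTerm

/-- Functions on `F` that satisfy the five-term relation of the cross-ratio, extended by `0` to the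
degenerate cross-ratios `0` and `1`. With Lean's convention `x / 0 = 0` such a function vanishes at
every cross-ratio of four points two of which coincide. -/
structure FiveTermFunction {F : Type*} [Field F] {M : Type*} [AddCommGroup M] (f : F → M) :
    Prop where
  map_zero : f 0 = 0
  map_one : f 1 = 0
  sum_eq_zero : ∀ p : Fin 5 → Fin 2 → F, (∀ i j, i ≠ j → det2 (p i) (p j) ≠ 0) →
    ∑ i : Fin 5, (-1 : ℤ) ^ (i : ℕ) • f (crossRatio fun k => p (i.succAbove k)) = 0

variable {F : Type*} [Field F]

lemma det2_plucker (a b c d : Fin 2 → F) :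
    det2 a c * det2 b d - det2 a d * det2 b c = det2 a b * det2 c d := by
  simp only [det2]
  ring

lemma crossRatio_comp_swap₀₁ (p : Fin 4 → Fin 2 → F) :
    crossRatio (p ∘ Equiv.swap 0 1) = (crossRatio p)⁻¹ := by
  have h : ⇑(Equiv.swap (0 : Fin 4) 1) = ![1, 0, 2, 3] := by decide
  simp only [crossRatio, h, Function.comp_apply, Matrix.cons_val, inv_div]
  congr 1 <;> exact mul_comm _ _

lemma crossRatio_comp_swap₂₃ (p : Fin 4 → Fin 2 → F) :
    crossRatio (p ∘ Equiv.swap 2 3) = (crossRatio p)⁻¹ := by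
  have h : ⇑(Equiv.swap (2 : Fin 4) 3) = ![0, 1, 3, 2] := by decide
  simp only [crossRatio, h, Function.comp_apply, Matrix.cons_val, inv_div]

lemma crossRatio_comp_swap₁₂ (p : Fin 4 → Fin 2 → F)
    (hp : det2 (p 0) (p 2) * det2 (p 1) (p 3) ≠ 0) :
    crossRatio (p ∘ Equiv.swap 1 2) = crossRatio p / (crossRatio p - 1) := by
  have h : ⇑(Equiv.swap (1 : Fin 4) 2) = ![0, 2, 1, 3] := by decide
  have hsub : crossRatio p - 1 =
      -(det2 (p 0) (p 1) * det2 (p 2) (p 3)) / (det2 (p 0) (p 2) * det2 (p 1) (p 3)) := by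
    rw [crossRatio, div_sub_one hp, ← det2_plucker (p 0) (p 1), neg_sub]
  rw [hsub, crossRatio, crossRatio, div_div_div_cancel_right₀ hp]
  simp only [h, Function.comp_apply, Matrix.cons_val, det2_swap (p 2) (p 1)]
  rw [mul_neg, neg_div, div_neg]

namespace FiveTermFunction

variable {M : Type*} [AddCommGroup M] {f : F → M}

lemma sum_five_points (hf : FiveTermFunction f) (p : Fin 5 → Fin 2 → F)
    (hp : ∀ i j, i < j → det2 (p i) (p j) ≠ 0) :
    f (crossRatio ![p 1, p 2, p 3, p 4]) - f (crossRatio ![p 0, p 2, p 3, p 4])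
      + f (crossRatio ![p 0, p 1, p 3, p 4]) - f (crossRatio ![p 0, p 1, p 2, p 4])
      + f (crossRatio ![p 0, p 1, p 2, p 3]) = 0 := by
  have h := hf.sum_eq_zero p fun i j hij => by
    rcases lt_or_gt_of_ne hij with h | h
    · exact hp i j h
    · rw [det2_swap]
      exact neg_ne_zero.mpr (hp j i h)
  simpa [Fin.sum_univ_five, crossRatio, succAbove_five, ← sub_eq_add_neg, pow_succ] using h

lemma map_crossRatio_of_det2_eq_zero (hf : FiveTermFunction f) (p : Fin 4 → Fin 2 → F)
    (hp : det2 (p 2) (p 3) = 0) : f (crossRatio p) = 0 := by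
  have h := det2_plucker (p 0) (p 1) (p 2) (p 3)
  rw [hp, mul_zero, sub_eq_zero] at h
  rw [crossRatio, ← h]
  rcases eq_or_ne (det2 (p 0) (p 2) * det2 (p 1) (p 3)) 0 with h0 | h0
  · rw [h0, div_zero, hf.map_zero]
  · rw [div_self h0, hf.map_one]

lemma sum_five_points_of_last_pair (hf : FiveTermFunction f) (p : Fin 5 → Fin 2 → F)
    (hp : ∀ i j, i < j → (i, j) ≠ (3, 4) → det2 (p i) (p j) ≠ 0) :
    f (crossRatio ![p 1, p 2, p 3, p 4]) - f (crossRatio ![p 0, p 2, p 3, p 4])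
      + f (crossRatio ![p 0, p 1, p 3, p 4]) - f (crossRatio ![p 0, p 1, p 2, p 4])
      + f (crossRatio ![p 0, p 1, p 2, p 3]) = 0 := by
  by_cases h34 : det2 (p 3) (p 4) = 0
  · have h_same : crossRatio ![p 0, p 1, p 2, p 4] = crossRatio ![p 0, p 1, p 2, p 3] := by
      have h := det2_plucker (p 0) (p 1) (p 3) (p 4)
      rw [h34, mul_zero, sub_eq_zero] at h
      have h02 := hp 0 2 (by decide) (by decide)
      have h13 := hp 1 3 (by decide) (by decide)
      have h14 := hp 1 4 (by decide) (by decide)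
      simp only [crossRatio, Matrix.cons_val]
      rw [div_eq_div_iff (mul_ne_zero h02 h14) (mul_ne_zero h02 h13)]
      linear_combination (-det2 (p 1) (p 2) * det2 (p 0) (p 2)) * h
    rw [hf.map_crossRatio_of_det2_eq_zero _ h34, hf.map_crossRatio_of_det2_eq_zero _ h34,
      hf.map_crossRatio_of_det2_eq_zero _ h34, h_same]
    abel
  · refine hf.sum_five_points p fun i j hij => ?_
    by_cases h : (i, j) = (3, 4)
    · rwa [(Prod.mk.inj h).1, (Prod.mk.inj h).2]
    · exact hp i j hij h

lemma relation_infty_zero (hf : FiveTermFunction f) {u v w : F} (hu : u ≠ 0) (hv : v ≠ 0)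
    (hw : w ≠ 0) (huv : u ≠ v) (huw : u ≠ w) (hvw : v ≠ w) :
    f (w * (u - v) / (v * (u - w))) - f ((u - v) / (u - w)) + f (v / w) - f (u / w)
      + f (u / v) = 0 := by
  have h := hf.sum_five_points ![![1, 0], ![0, 1], ![u, 1], ![v, 1], ![w, 1]] (by
    intro i j hij
    fin_cases i <;> fin_cases j <;> first
      | exact absurd hij (by decide)
      | simp [det2, hu, hv, hw, sub_ne_zero.mpr huv, sub_ne_zero.mpr huw, sub_ne_zero.mpr hvw])
  simpa only [crossRatio, det2, Matrix.cons_val, zero_mul, one_mul, mul_one, zero_sub, sub_zero,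
    neg_mul, mul_neg, neg_div_neg_eq, inv_div, mul_zero] using h

lemma relation_infty_middle_zero (hf : FiveTermFunction f) {u v w : F} (hu : u ≠ 0) (hv : v ≠ 0)
    (hw : w ≠ 0) (huv : u ≠ v) (huw : u ≠ w) (hvw : v ≠ w) :
    f ((u - w) * v / ((u - v) * w)) - f (v / w) + f ((u - v) / (u - w)) - f (u / (u - w))
      + f (u / (u - v)) = 0 := by
  have h := hf.sum_five_points ![![1, 0], ![u, 1], ![0, 1], ![v, 1], ![w, 1]] (by
    intro i j hij
    fin_cases i <;> fin_cases j <;> first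
      | exact absurd hij (by decide)
      | simp [det2, hu, hv, hw, sub_ne_zero.mpr huv, sub_ne_zero.mpr huw, sub_ne_zero.mpr hvw])
  simpa only [crossRatio, det2, Matrix.cons_val, zero_mul, one_mul, mul_one, zero_sub, sub_zero,
    neg_mul, mul_neg, neg_div_neg_eq, inv_div, mul_zero] using h

lemma map_mul_add_map_mul_inv (hf : FiveTermFunction f) {a b : F} (ha : a ≠ 0) (ha1 : a ≠ 1)
    (hb : b ≠ 0) (hb1 : b ≠ 1) (hab : a * b ≠ 1) :
    f (a * b) + f (a * b)⁻¹ = (f a + f a⁻¹) - (f b + f b⁻¹) := by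
  have ha' : 1 - a ≠ 0 := sub_ne_zero.mpr ha1.symm
  have hb' : 1 - b ≠ 0 := sub_ne_zero.mpr hb1.symm
  -- `u` is chosen such that `(u - 1) / (u - b) = a`
  obtain ⟨u, hu⟩ : ∃ u, u = (1 - a * b) / (1 - a) := ⟨_, rfl⟩
  have hu0 : u ≠ 0 := hu ▸ div_ne_zero (sub_ne_zero.mpr hab.symm) ha'
  have hub : u - b = (1 - b) / (1 - a) := by rw [hu]; field_simp; ring
  have hua : u - 1 = a * (u - b) := by rw [hub, hu]; field_simp; ring
  have hub0 : u - b ≠ 0 := hub ▸ div_ne_zero hb' ha'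
  have hu1 : u - 1 ≠ 0 := hua ▸ mul_ne_zero ha hub0
  have h₁ := hf.relation_infty_zero hu0 one_ne_zero hb (sub_ne_zero.mp hu1) (sub_ne_zero.mp hub0)
    hb1.symm
  have h₂ := hf.relation_infty_zero hu0 hb one_ne_zero (sub_ne_zero.mp hub0) (sub_ne_zero.mp hu1)
    hb1
  have e₁ : (u - 1) / (u - b) = a := by rw [hua, mul_div_cancel_right₀ _ hub0]
  have e₂ : (u - b) / (u - 1) = a⁻¹ := by rw [← e₁, inv_div]
  have e₃ : b * (u - 1) / (1 * (u - b)) = a * b := by rw [one_mul, mul_div_assoc, e₁, mul_comm]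
  have e₄ : 1 * (u - b) / (b * (u - 1)) = (a * b)⁻¹ := by rw [← e₃, inv_div]
  rw [e₃, e₁, one_div, div_one] at h₁
  rw [e₄, e₂, div_one, div_one] at h₂
  linear_combination (norm := abel) h₁ + h₂

variable [Module F M] [NeZero (2 : F)] [NeZero (3 : F)]

lemma exists_ne_zero_one (x : F) : ∃ y : F, y ≠ 0 ∧ y ≠ 1 ∧ y ≠ x := by
  have h2 := NeZero.ne (2 : F)
  have h3 := NeZero.ne (3 : F)
  by_cases hx : x = 2
  · refine ⟨-1, by simp, fun h => h2 ?_, fun h => h3 ?_⟩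
    · linear_combination -h
    · linear_combination -h - hx
  · exact ⟨2, h2, fun h => one_ne_zero (α := F) (by linear_combination h), Ne.symm hx⟩

lemma map_inv (hf : FiveTermFunction f) (x : F) : f x⁻¹ = -f x := by
  rcases eq_or_ne x 0 with rfl | hx0
  · simp [hf.map_zero]
  rcases eq_or_ne x 1 with rfl | hx1
  · simp [hf.map_one]
  obtain ⟨a, ha0, ha1, hax⟩ := exists_ne_zero_one x
  obtain ⟨b, rfl⟩ : ∃ b, x = a * b := ⟨x / a, (mul_div_cancel₀ x ha0).symm⟩
  have hb0 : b ≠ 0 := right_ne_zero_of_mul hx0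
  have hb1 : b ≠ 1 := fun h => hax (by rw [h, mul_one])
  have hab := hf.map_mul_add_map_mul_inv ha0 ha1 hb0 hb1 hx1
  have hba := hf.map_mul_add_map_mul_inv hb0 hb1 ha0 ha1 (mul_comm a b ▸ hx1)
  rw [mul_comm b a, ← neg_sub, ← hab] at hba
  exact eq_neg_of_add_eq_zero_right (eq_zero_of_eq_neg F hba)

lemma map_add_map_div_sub_one (hf : FiveTermFunction f) {x y : F} (hx0 : x ≠ 0) (hx1 : x ≠ 1)
    (hy0 : y ≠ 0) (hy1 : y ≠ 1) : f x + f (x / (x - 1)) = f y + f (y / (y - 1)) := by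
  rcases eq_or_ne x y with rfl | hxy
  · rfl
  have h₁ := hf.relation_infty_zero one_ne_zero (inv_ne_zero hx0) (inv_ne_zero hy0)
    (inv_ne_one.mpr hx1).symm (inv_ne_one.mpr hy1).symm (inv_injective.ne hxy)
  have h₂ := hf.relation_infty_middle_zero one_ne_zero (inv_ne_zero hx0) (inv_ne_zero hy0)
    (inv_ne_one.mpr hx1).symm (inv_ne_one.mpr hy1).symm (inv_injective.ne hxy)
  have e {z : F} (hz : z ≠ 0) : 1 / (1 - z⁻¹) = z / (z - 1) := by
    rw [← mul_div_mul_left _ _ hz, mul_one, mul_sub, mul_one, mul_inv_cancel₀ hz]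
  rw [mul_comm (1 - y⁻¹), mul_comm (1 - x⁻¹), ← inv_div, hf.map_inv, e hx0, e hy0] at h₂
  rw [one_div, one_div, inv_inv, inv_inv] at h₁
  linear_combination (norm := abel) h₁ + h₂

lemma map_div_sub_one (hf : FiveTermFunction f) (x : F) : f (x / (x - 1)) = -f x := by
  rcases eq_or_ne x 0 with rfl | hx0
  · simp [hf.map_zero]
  rcases eq_or_ne x 1 with rfl | hx1
  · simp [hf.map_zero, hf.map_one]
  -- The constant `f x + f (x / (x - 1))` is compared at `x⁻¹`, `1 - x` and `x`.
  have h_inv := hf.map_add_map_div_sub_one (inv_ne_zero hx0) (inv_ne_one.mpr hx1) hx0 hx1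
  have h_sub := hf.map_add_map_div_sub_one (sub_ne_zero.mpr hx1.symm) (by simpa using hx0) hx0 hx1
  have e_inv : x⁻¹ / (x⁻¹ - 1) = (1 - x)⁻¹ := by
    rw [← mul_div_mul_left _ _ hx0, mul_inv_cancel₀ hx0, mul_sub, mul_inv_cancel₀ hx0, mul_one,
      one_div]
  have e_sub : (1 - x) / (1 - x - 1) = (x / (x - 1))⁻¹ := by
    rw [inv_div, ← neg_div_neg_eq]
    congr 1 <;> ring
  rw [e_inv, hf.map_inv, hf.map_inv] at h_inv
  rw [e_sub, hf.map_inv] at h_sub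
  have h : (3 : F) • (f (x / (x - 1)) + f x) = 0 := by
    linear_combination (norm := module) -h_inv - h_sub
  exact eq_neg_of_add_eq_zero_left ((smul_eq_zero.mp h).resolve_left (NeZero.ne 3))

lemma map_crossRatio_swap₁₂ (hf : FiveTermFunction f) (p : Fin 4 → Fin 2 → F) :
    f (crossRatio (p ∘ Equiv.swap 1 2)) = -f (crossRatio p) := by
  rcases eq_or_ne (det2 (p 0) (p 2) * det2 (p 1) (p 3)) 0 with hp | hp
  · have h : ⇑(Equiv.swap (1 : Fin 4) 2) = ![0, 2, 1, 3] := by decide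
    have hplucker := det2_plucker (p 0) (p 1) (p 2) (p 3)
    rw [hp, zero_sub] at hplucker
    simp only [crossRatio, h, Function.comp_apply, Matrix.cons_val, hp, div_zero, hf.map_zero,
      neg_zero, ← hplucker, det2_swap (p 2) (p 1), mul_neg]
    rcases eq_or_ne (det2 (p 0) (p 3) * det2 (p 1) (p 2)) 0 with h0 | h0
    · rw [h0, neg_zero, div_zero, hf.map_zero]
    · rw [div_self (neg_ne_zero.mpr h0), hf.map_one]
  · rw [crossRatio_comp_swap₁₂ p hp, hf.map_div_sub_one]

lemma map_crossRatio_perm (hf : FiveTermFunction f) (σ : Equiv.Perm (Fin 4))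
    (p : Fin 4 → Fin 2 → F) :
    f (crossRatio (p ∘ σ)) = (Equiv.Perm.sign σ : ℤ) • f (crossRatio p) := by
  have hσ : σ ∈ Submonoid.closure (Set.range fun i : Fin 3 => Equiv.swap i.castSucc i.succ) := by
    rw [Equiv.Perm.mclosure_swap_castSucc_succ]
    exact Submonoid.mem_top σ
  induction hσ using Submonoid.closure_induction generalizing p with
  | mem _ h =>
    obtain ⟨i, rfl⟩ := h
    rw [Equiv.Perm.sign_swap (Fin.castSucc_lt_succ).ne, Units.val_neg, Units.val_one, neg_one_smul]
    fin_cases i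
    · exact (congrArg f (crossRatio_comp_swap₀₁ p)).trans (hf.map_inv _)
    · exact hf.map_crossRatio_swap₁₂ p
    · exact (congrArg f (crossRatio_comp_swap₂₃ p)).trans (hf.map_inv _)
  | one => simp
  | mul σ τ _ _ hσ hτ =>
    rw [Equiv.Perm.coe_mul, ← Function.comp_assoc, hτ, hσ, smul_smul, map_mul, Units.val_mul,
      mul_comm]

end FiveTermFunction

lemma dilogOf_fiveTerm [NeZero (2 : F)] (D : Derivation ℤ F F) :
    FiveTermFunction (dilogOf D) where
  map_zero := by simp [dilogOf, symb2, symb, symbB2, intSymb]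
  map_one := by simp [dilogOf, symb2, symb, symbB2, intSymb]
  sum_eq_zero p hp := by
    refine Prod.ext ?_ ?_
    · rw [Prod.fst_sum]
      exact symb2_crossRatio D p hp
    · have h := congrArg (fun b => (1 : F) ⊗ₜ[ℤ] b) (symbB2_crossRatio p hp)
      simp only [TensorProduct.tmul_sum, TensorProduct.tmul_smul, TensorProduct.tmul_zero] at h
      rw [Prod.snd_sum]
      exact h

end FiveTerm

section Volumes

variable {F : Type*} [Field F] {V : Type*} [AddCommGroup V] [Module F V] (ω : VolumeForm F V)

lemma vol_swap₀₁ (x y z : V) : vol ω y x z = -vol ω x y z := by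
  rw [vol, vol, ← ω.1.map_swap ![x, y, z] (by decide : (0 : Fin 3) ≠ 1)]
  congr 1
  ext k
  fin_cases k <;> rfl

lemma vol_swap₁₂ (x y z : V) : vol ω x z y = -vol ω x y z := by
  rw [vol, vol, ← ω.1.map_swap ![x, y, z] (by decide : (1 : Fin 3) ≠ 2)]
  congr 1
  ext k
  fin_cases k <;> rfl

lemma vol_eq_zero (x y : V) : vol ω x y y = 0 :=
  ω.1.map_eq_zero_of_eq ![x, y, y] (i := 1) (j := 2) rfl (by decide)

lemma vol_sub_smul (x y : V) (a b : F) (z w : V) :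
    vol ω x y (a • z - b • w) = a * vol ω x y z - b * vol ω x y w := by
  have h (u : V) : vol ω x y u = ω.1 (Function.update ![x, y, 0] 2 u) := by
    rw [vol]
    congr 1
    ext k
    fin_cases k <;> rfl
  rw [h, h, h, ω.1.map_update_sub, ω.1.map_update_smul, ω.1.map_update_smul, smul_eq_mul,
    smul_eq_mul]

lemma exists_projection [Fact (Module.finrank F V = 3)] (x : V) :
    ∃ π : V → Fin 2 → F, ∀ a b, vol ω x a b = det2 (π a) (π b) := by
  obtain ⟨c, u, hu⟩ := vol_coord ω
  by_cases h0 : u x 0 = 0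
  · by_cases h1 : u x 1 = 0
    · refine ⟨fun a => ![c * u x 2 * u a 0, u a 1], fun a b => ?_⟩
      simp only [hu, det2, h0, h1, Matrix.cons_val]
      ring
    · refine ⟨fun a => ![c * u a 0, u x 2 * u a 1 - u x 1 * u a 2], fun a b => ?_⟩
      simp only [hu, det2, h0, Matrix.cons_val]
      ring
  · refine ⟨fun a => ![c / u x 0 * (u x 0 * u a 1 - u x 1 * u a 0), u x 0 * u a 2 - u x 2 * u a 0],
      fun a b => ?_⟩
    simp only [hu, det2, Matrix.cons_val]
    field_simp
    ring

lemma exists_projRatio_eq_crossRatio [Fact (Module.finrank F V = 3)] (x : V) :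
    ∃ π : V → Fin 2 → F, (∀ a b, vol ω x a b = det2 (π a) (π b)) ∧
      ∀ y : Fin 4 → V, projRatio ω x y = crossRatio (π ∘ y) := by
  obtain ⟨π, hπ⟩ := exists_projection ω x
  exact ⟨π, hπ, fun y => by simp only [projRatio, crossRatio, hπ, Function.comp_apply]⟩

section Ratios

variable [Fact (Module.finrank F V = 3)] {M : Type*} [AddCommGroup M] {f : F → M}

lemma FiveTermFunction.sum_projRatio (hf : FiveTermFunction f) (x : V) (z : Fin 5 → V)
    (hz : ∀ i j, i < j → (i, j) ≠ (3, 4) → vol ω x (z i) (z j) ≠ 0) :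
    f (projRatio ω x ![z 1, z 2, z 3, z 4]) - f (projRatio ω x ![z 0, z 2, z 3, z 4])
      + f (projRatio ω x ![z 0, z 1, z 3, z 4]) - f (projRatio ω x ![z 0, z 1, z 2, z 4])
      + f (projRatio ω x ![z 0, z 1, z 2, z 3]) = 0 := by
  obtain ⟨π, hvol, hratio⟩ := exists_projRatio_eq_crossRatio ω x
  have h := hf.sum_five_points_of_last_pair (π ∘ z) fun i j hij hne => hvol _ _ ▸ hz i j hij hne
  simpa only [hratio, crossRatio, Function.comp_apply, Matrix.cons_val] using h

lemma FiveTermFunction.map_projRatio_perm [NeZero (2 : F)] [NeZero (3 : F)] [Module F M]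
    (hf : FiveTermFunction f) (x : V) (y : Fin 4 → V) (σ : Equiv.Perm (Fin 4)) :
    f (projRatio ω x (y ∘ σ)) = (Equiv.Perm.sign σ : ℤ) • f (projRatio ω x y) := by
  obtain ⟨π, -, hratio⟩ := exists_projRatio_eq_crossRatio ω x
  rw [hratio, hratio, ← Function.comp_assoc, hf.map_crossRatio_perm]

lemma FiveTermFunction.sum_dual (hf : FiveTermFunction f) (l : Generic F V 5) :
    ∑ i : Fin 5, (-1 : ℤ) ^ (i : ℕ) •
      f (projRatio ω (l.1 i) fun k => l.1 (i.succAbove k)) = 0 := by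
  obtain ⟨p, hp, h⟩ := exists_dual ω l
  simp only [h]
  exact hf.sum_eq_zero p hp

lemma one_sub_projRatio {x : V} {y : Fin 4 → V} (h02 : vol ω x (y 0) (y 2) ≠ 0)
    (h13 : vol ω x (y 1) (y 3) ≠ 0) :
    1 - projRatio ω x y = (vol ω x (y 0) (y 1) * vol ω x (y 2) (y 3)) /
      (vol ω x (y 0) (y 2) * vol ω x (y 1) (y 3)) := by
  obtain ⟨π, hvol, -⟩ := exists_projRatio_eq_crossRatio ω x
  rw [projRatio, one_sub_div (mul_ne_zero h02 h13)]
  simp only [hvol, det2_plucker]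

end Ratios

end Volumes

section GenericAlternation

variable {F : Type*} [Field F] {V : Type*} [AddCommGroup V] [Module F V] {m n : ℕ}

/-- The subfamily of a tuple in generic position given by an injection of index sets. -/
def Generic.comp (l : Generic F V n) (e : Fin m ↪ Fin n) : Generic F V m :=
  ⟨l.1 ∘ e, fun s hs => by
    refine LinearIndepOn.comp_of_image ?_ e.injective.injOn
    simpa using l.2 (s.map e) (by simpa using hs)⟩

variable {N : Type*} [AddCommGroup N] {G H : (Fin n → V) → N}

lemma altSum_congr (l : Generic F V n) (h : ∀ y : Generic F V n, G y.1 = H y.1) :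
    altSum l.1 G = altSum l.1 H :=
  Finset.sum_congr rfl fun σ _ => congrArg _ (h (l.comp σ.toEmbedding))

lemma altSum_eq_smul_of_comp_perm (l : Generic F V n) (π : Equiv.Perm (Fin n))
    (h : ∀ y : Generic F V n, H y.1 = G (y.1 ∘ π)) :
    altSum l.1 H = (Equiv.Perm.sign π : ℤ) • altSum l.1 G := by
  rw [altSum_congr (H := fun y => G (y ∘ π)) l h, altSum_comp_perm]

lemma altSum_eq_zero_of_odd [NeZero (2 : F)] [Module F N] (l : Generic F V n)
    {π : Equiv.Perm (Fin n)} (hπ : Equiv.Perm.sign π = -1)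
    (h : ∀ y : Generic F V n, G y.1 = G (y.1 ∘ π)) : altSum l.1 G = 0 :=
  eq_zero_of_eq_neg F ((altSum_eq_smul_of_comp_perm l π h).trans (by simp [hπ]))

lemma altSum_eq_zero_of_even [NeZero (2 : F)] [Module F N] (l : Generic F V n)
    {π : Equiv.Perm (Fin n)} (hπ : Equiv.Perm.sign π = 1)
    (h : ∀ y : Generic F V n, G y.1 = -G (y.1 ∘ π)) : altSum l.1 G = 0 :=
  eq_zero_of_eq_neg F <|
    (altSum_eq_smul_of_comp_perm (G := -G) l π h).trans (by simp [hπ])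

end GenericAlternation

section LogVolumes

variable {F : Type*} [Field F] [NeZero (2 : F)] {V : Type*} [AddCommGroup V] [Module F V]
  (ω : VolumeForm F V)

/-- The formal logarithm of the volume of three vectors; it is symmetric in them. -/
def logVol (x y z : V) : LogSpace F := logOf (vol ω x y z)

lemma logVol_swap₀₁ (x y z : V) : logVol ω y x z = logVol ω x y z := by
  rw [logVol, vol_swap₀₁, logOf_neg, logVol]

lemma logVol_swap₁₂ (x y z : V) : logVol ω x z y = logVol ω x y z := by
  rw [logVol, vol_swap₁₂, logOf_neg, logVol]

lemma exists_perm_succAbove {n : ℕ} (σ : Equiv.Perm (Fin (n + 1))) (k : Fin (n + 1)) :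
    ∃ τ : Equiv.Perm (Fin n), ∀ j, (σ k).succAbove (τ j) = σ (k.succAbove j) := by
  choose g hg using fun j => Fin.exists_succAbove_eq (σ.injective.ne (k.succAbove_ne j))
  have g_injective : Function.Injective g := fun i j hij =>
    k.succAbove_right_injective (σ.injective (by rw [← hg, ← hg, hij]))
  exact ⟨Equiv.ofBijective g (Finite.injective_iff_bijective.mp g_injective), hg⟩

lemma logVol_comp_perm (x : Fin 3 → V) (ρ : Equiv.Perm (Fin 3)) :
    logVol ω (x (ρ 0)) (x (ρ 1)) (x (ρ 2)) = logVol ω (x 0) (x 1) (x 2) := by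
  have hvol (z : Fin 3 → V) : logVol ω (z 0) (z 1) (z 2) = logOf (ω.1 z) := by
    rw [logVol, vol]
    congr
    ext k
    fin_cases k <;> rfl
  rw [hvol, ← Function.comp_apply (f := x), ← Function.comp_apply (f := x),
    ← Function.comp_apply (f := x), hvol, AlternatingMap.map_perm]
  rcases Int.units_eq_one_or (Equiv.Perm.sign ρ) with hρ | hρ
  · rw [hρ, one_smul]
  · rw [hρ, Units.neg_smul, one_smul, logOf_neg]

lemma logOf_omitVol_comp_perm (y : Fin 4 → V) (σ : Equiv.Perm (Fin 4)) (k : Fin 4) :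
    logOf (omitVol ω (y ∘ σ) k) = logOf (omitVol ω y (σ k)) := by
  obtain ⟨τ, hτ⟩ := exists_perm_succAbove σ k
  have h := logVol_comp_perm ω (fun j => y ((σ k).succAbove j)) τ
  simp only [hτ] at h
  exact h

section CyclicWedgeSums

variable (D : Derivation ℤ F F)

lemma sum_dlogMap_smul_logWedge (o : Fin 4 → LogSpace F) :
    ∑ i : Fin 4, (-1 : ℤ) ^ (i : ℕ) •
        dlogMap D (o i) • logWedge F (o (i + 1) - o (i + 2)) (o (i + 3) - o (i + 2)) =
      ∑ j : Fin 4, (-1 : ℤ) ^ (j : ℕ) • cyclicWedge D (j.removeNth o 0) (j.removeNth o 1)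
        (j.removeNth o 2) := by
  have s₁₃ := logWedge_swap (o 3) (o 1)
  have s₀₂ := logWedge_swap (o 2) (o 0)
  have s₀₃ := logWedge_swap (o 3) (o 0)
  simp only [map_sub, LinearMap.sub_apply, logWedge_self, sub_zero, Fin.sum_univ_four,
    Fin.coe_ofNat_eq_mod, Nat.reduceMod, pow_zero, pow_succ, zero_add, one_smul, mul_neg, mul_one,
    Fin.reduceAdd, s₀₂, s₀₃, s₁₃, sub_neg_eq_add, neg_smul, neg_neg, cyclicWedge, Fin.removeNth,
    Fin.succAbove, Fin.isValue, Fin.castSucc_zero, Fin.succ_zero_eq_one, Fin.castSucc_one,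
    Fin.succ_one_eq_two, Fin.reduceCastSucc, Fin.reduceSucc, lt_self_iff_false, ↓reduceIte,
    not_lt_zero, smul_neg, zero_lt_one, Fin.lt_one_iff, Fin.reduceEq, Fin.reduceLT]
  module

lemma tau0Val_eq_sum [Fact (Module.finrank F V = 3)] (l : Generic F V 4) :
    tau0Val D ω l.1 =
      ∑ j : Fin 4, (-1 : ℤ) ^ (j : ℕ) • cyclicWedge D (logOf (omitVol ω l.1 (j.succAbove 0)))
        (logOf (omitVol ω l.1 (j.succAbove 1))) (logOf (omitVol ω l.1 (j.succAbove 2))) := by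
  have h (i : Fin 4) : dlog D (omitVol ω l.1 i) ⊗ₜ[ℤ]
      wedge (unitOf (omitVol ω l.1 (i + 1) / omitVol ω l.1 (i + 2)))
        (unitOf (omitVol ω l.1 (i + 3) / omitVol ω l.1 (i + 2))) =
      dlogMap D (logOf (omitVol ω l.1 i)) •
        logWedge F (logOf (omitVol ω l.1 (i + 1)) - logOf (omitVol ω l.1 (i + 2)))
          (logOf (omitVol ω l.1 (i + 3)) - logOf (omitVol ω l.1 (i + 2))) := by
    rw [← logOf_div (omitVol_ne_zero ω l _) (omitVol_ne_zero ω l _),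
      ← logOf_div (omitVol_ne_zero ω l _) (omitVol_ne_zero ω l _), logWedge_logOf, dlogMap_logOf,
      TensorProduct.smul_tmul', smul_eq_mul, mul_one]
  simp only [tau0Val, h]
  exact sum_dlogMap_smul_logWedge D fun i => logOf (omitVol ω l.1 i)

omit [NeZero (2 : F)] in
lemma altSum_cyclicWedge (o : Fin 4 → LogSpace F) :
    altSum o (fun y => cyclicWedge D (y 1) (y 2) (y 3)) = (6 : ℤ) •
      ∑ j : Fin 4, (-1 : ℤ) ^ (j : ℕ) • cyclicWedge D (j.removeNth o 0) (j.removeNth o 1)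
        (j.removeNth o 2) := by
  rw [altSum_succ, Finset.smul_sum]
  refine Finset.sum_congr rfl fun j _ => ?_
  rw [smul_comm]
  congr 1
  generalize j.removeNth o = x
  refine (altSum_three x (cyclicWedge D)).trans ?_
  rw [cyclicWedge_rotate D (x 2) (x 0), ← cyclicWedge_rotate D (x 0) (x 1),
    cyclicWedge_rotate D (x 0) (x 2), cyclicWedge_rotate D (x 2) (x 1),
    cyclicWedge_swap D (x 0) (x 1)]
  module

lemma altSum_cyclicWedge_logVol [Fact (Module.finrank F V = 3)] (l : Generic F V 4) :
    altSum l.1 (fun y => cyclicWedge D (logVol ω (y 0) (y 2) (y 3)) (logVol ω (y 0) (y 1) (y 3))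
      (logVol ω (y 0) (y 1) (y 2))) = (6 : ℤ) • tau0Val D ω l.1 := by
  rw [tau0Val_eq_sum]
  refine Eq.trans ?_ (altSum_cyclicWedge D fun i => logOf (omitVol ω l.1 i))
  rw [altSum_apply, altSum_apply]
  refine Finset.sum_congr rfl fun σ _ => ?_
  simp only [Function.comp_apply, ← logOf_omitVol_comp_perm]
  rfl

lemma altSum_cyclicWedge_pencil {X : Type*} (e : X → X → LogSpace F) (he : ∀ a b, e b a = e a b)
    (z : Fin 4 → X) (c : LogSpace F) :
    altSum z (fun y => cyclicWedge D (e (y 0) (y 1)) (e (y 0) (y 2)) c) =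
      (-2 : ℤ) • cyclicWedge D (e (z 0) (z 1) + e (z 2) (z 3) - (e (z 0) (z 2) + e (z 1) (z 3)))
        (e (z 0) (z 3) + e (z 1) (z 2) - (e (z 0) (z 2) + e (z 1) (z 3))) c := by
  have s (x y) := cyclicWedge_swap D x y c
  have h (i : Fin 4) :
      altSum (i.removeNth z) (fun y => cyclicWedge D (e (z i) (y 0)) (e (z i) (y 1)) c) =
        (2 : ℤ) • (cyclicWedge D (e (z i) (i.removeNth z 0)) (e (z i) (i.removeNth z 1)) c +
          cyclicWedge D (e (z i) (i.removeNth z 1)) (e (z i) (i.removeNth z 2)) c +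
          cyclicWedge D (e (z i) (i.removeNth z 2)) (e (z i) (i.removeNth z 0)) c) := by
    refine (altSum_three _ fun a b _ => cyclicWedge D (e (z i) a) (e (z i) b) c).trans ?_
    rw [s (e _ (i.removeNth z 0)) (e _ (i.removeNth z 1)),
      s (e _ (i.removeNth z 1)) (e _ (i.removeNth z 2)),
      s (e _ (i.removeNth z 2)) (e _ (i.removeNth z 0))]
    module
  refine (altSum_succ z _).trans ((Finset.sum_congr rfl fun i _ => congrArg _ (h i)).trans ?_)
  rw [cyclicWedge_sub_sub]
  simp only [Nat.reduceAdd, Fin.sum_univ_four, Fin.removeNth, Fin.succAbove, Fin.isValue,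
    Fin.castSucc_zero, Fin.succ_zero_eq_one, Fin.castSucc_one, Fin.succ_one_eq_two,
    Fin.reduceCastSucc, Fin.reduceSucc, Fin.reduceLT, Fin.reduceEq, Fin.lt_one_iff,
    Fin.coe_ofNat_eq_mod, Nat.reduceMod, lt_self_iff_false, not_lt_zero, zero_lt_one, ↓reduceIte,
    pow_zero, pow_succ, mul_neg, mul_one, neg_neg, neg_smul, one_smul, he (z 0), he (z 1) (z 2),
    he (z 1) (z 3), he (z 2) (z 3), cyclicWedge_add_middle, cyclicWedge_add_left]
  rw [s (e (z 0) (z 1)) (e (z 0) (z 3)), s (e (z 2) (z 3)) (e (z 1) (z 2)),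
    s (e (z 0) (z 2)) (e (z 0) (z 1)), s (e (z 0) (z 3)) (e (z 0) (z 2)),
    s (e (z 0) (z 2)) (e (z 2) (z 3)), s (e (z 1) (z 2)) (e (z 0) (z 2))]
  module

end CyclicWedgeSums

end LogVolumes

section SecondSquare

variable {F : Type*} [Field F] [NeZero (2 : F)]

lemma bdryMid_midPairing (D : Derivation ℤ F F) {x : F} (h0 : x ≠ 0) (h1 : x ≠ 1) (b : F) :
    bdryMid D (midPairing D (logOf b) (dilogOf D x)) =
      cyclicWedge D (logOf (1 - x)) (logOf x) (logOf b) := by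
  rw [midPairing_logOf_dilogOf, bdryMid_apply D _ _ h0 h1 h0 h1, cyclicWedge,
    logWedge_swap (logOf b)]
  simp only [logWedge_logOf, dlogMap_logOf, smul_neg, TensorProduct.smul_tmul', smul_eq_mul,
    mul_one, sub_eq_add_neg]

variable {V : Type*} [AddCommGroup V] [Module F V] (ω : VolumeForm F V) (D : Derivation ℤ F F)

lemma sum_logOf_omitVol_comp_perm (y : Fin 4 → V) (σ : Equiv.Perm (Fin 4)) :
    ∑ k, logOf (omitVol ω (y ∘ σ) k) = ∑ k, logOf (omitVol ω y k) := by
  simp only [logOf_omitVol_comp_perm]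
  exact Equiv.sum_comp σ fun k => logOf (omitVol ω y k)

omit [NeZero (2 : F)] in
lemma tau1Val_eq_sum (l : Fin 5 → V) :
    tau1Val D ω l = (-(1 / 3) : F) • ∑ i : Fin 5, (-1 : ℤ) ^ (i : ℕ) •
      midPairing D (logOf (omitProd ω l i))
        (dilogOf D (projRatio ω (l i) (i.removeNth l))) := by
  simp only [tau1Val, midPairing_logOf_dilogOf]
  rfl

variable [Fact (Module.finrank F V = 3)]

omit [NeZero (2 : F)] in
lemma logOf_omitProd (l : Generic F V 5) (i : Fin 5) :
    logOf (omitProd ω l.1 i) = ∑ k, logOf (omitVol ω (i.removeNth l.1) k) :=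
  logOf_prod _ fun k _ => omitVol_ne_zero ω (face i l) k

lemma bdryMid_midPairing_projRatio (l : Generic F V 5) (i : Fin 5) (b : F) :
    bdryMid D (midPairing D (logOf b) (dilogOf D (projRatio ω (l.1 i) (i.removeNth l.1)))) =
      cyclicWedge D
        (logVol ω (l.1 i) (i.removeNth l.1 0) (i.removeNth l.1 1) +
          logVol ω (l.1 i) (i.removeNth l.1 2) (i.removeNth l.1 3) -
          (logVol ω (l.1 i) (i.removeNth l.1 0) (i.removeNth l.1 2) +
          logVol ω (l.1 i) (i.removeNth l.1 1) (i.removeNth l.1 3)))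
        (logVol ω (l.1 i) (i.removeNth l.1 0) (i.removeNth l.1 3) +
          logVol ω (l.1 i) (i.removeNth l.1 1) (i.removeNth l.1 2) -
          (logVol ω (l.1 i) (i.removeNth l.1 0) (i.removeNth l.1 2) +
          logVol ω (l.1 i) (i.removeNth l.1 1) (i.removeNth l.1 3))) (logOf b) := by
  have hvol {j k : Fin 4} (hjk : j ≠ k) :
      vol ω (l.1 i) (i.removeNth l.1 j) (i.removeNth l.1 k) ≠ 0 :=
    vol_ne_zero ω l (i.succAbove_ne j).symm (i.succAbove_ne k).symm
      (i.succAbove_right_injective.ne hjk)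
  have h02 := hvol (j := 0) (k := 2) (by decide)
  have h13 := hvol (j := 1) (k := 3) (by decide)
  have h03 := hvol (j := 0) (k := 3) (by decide)
  have h12 := hvol (j := 1) (k := 2) (by decide)
  have h01 := hvol (j := 0) (k := 1) (by decide)
  have h23 := hvol (j := 2) (k := 3) (by decide)
  have hsub := one_sub_projRatio ω h02 h13
  have h0 : projRatio ω (l.1 i) (i.removeNth l.1) ≠ 0 :=
    div_ne_zero (mul_ne_zero h03 h12) (mul_ne_zero h02 h13)
  have h1 : projRatio ω (l.1 i) (i.removeNth l.1) ≠ 1 := fun h => by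
    rw [h, sub_self] at hsub
    exact div_ne_zero (mul_ne_zero h01 h23) (mul_ne_zero h02 h13) hsub.symm
  rw [bdryMid_midPairing D h0 h1, hsub, projRatio]
  simp only [logOf_div (mul_ne_zero h01 h23) (mul_ne_zero h02 h13),
    logOf_div (mul_ne_zero h03 h12) (mul_ne_zero h02 h13), logOf_mul h01 h23, logOf_mul h02 h13,
    logOf_mul h03 h12, logVol]

lemma altSum_cyclicWedge_star (l : Generic F V 5) :
    altSum l.1 (fun y => cyclicWedge D (logVol ω (y 0) (y 1) (y 2)) (logVol ω (y 0) (y 1) (y 3))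
      (∑ k, logOf (omitVol ω (Fin.tail y) k))) =
      (-2 : ℤ) • ∑ i : Fin 5, (-1 : ℤ) ^ (i : ℕ) • bdryMid D (midPairing D
        (logOf (omitProd ω l.1 i)) (dilogOf D (projRatio ω (l.1 i) (i.removeNth l.1)))) := by
  rw [altSum_succ, Finset.smul_sum]
  refine Finset.sum_congr rfl fun i _ => ?_
  rw [smul_comm, bdryMid_midPairing_projRatio, ← altSum_cyclicWedge_pencil D (logVol ω (l.1 i))
    fun a b => logVol_swap₁₂ ω (l.1 i) a b, logOf_omitProd, altSum_apply, altSum_apply]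
  refine congrArg _ (Finset.sum_congr rfl fun σ _ => congrArg _ ?_)
  rw [Fin.tail_cons, sum_logOf_omitVol_comp_perm]
  rfl

lemma altSum_cyclicWedge_triangle (l : Generic F V 5) :
    altSum l.1 (fun y => cyclicWedge D (logVol ω (y 0) (y 1) (y 2)) (logVol ω (y 0) (y 1) (y 3))
      (logVol ω (y 1) (y 2) (y 3))) =
      (6 : ℤ) • ∑ i : Fin 5, (-1 : ℤ) ^ (i : ℕ) • tau0Val D ω (face i l).1 := by
  let π : Equiv.Perm (Fin 5) := Equiv.swap 0 4 * Equiv.swap 2 3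
  have sign_π : Equiv.Perm.sign π = 1 := by decide
  have hπ := altSum_eq_smul_of_comp_perm l π
    (G := fun y => cyclicWedge D (logVol ω (y 0) (y 1) (y 2)) (logVol ω (y 0) (y 1) (y 3))
      (logVol ω (y 1) (y 2) (y 3)))
    (H := fun y => cyclicWedge D (logVol ω (y 1) (y 3) (y 4)) (logVol ω (y 1) (y 2) (y 4))
      (logVol ω (y 1) (y 2) (y 3))) fun y => by
    change _ = cyclicWedge D (logVol ω (y.1 4) (y.1 1) (y.1 3))
      (logVol ω (y.1 4) (y.1 1) (y.1 2)) (logVol ω (y.1 1) (y.1 3) (y.1 2))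
    simp only [logVol_swap₀₁, logVol_swap₁₂]
  rw [sign_π, Units.val_one, one_smul] at hπ
  rw [← hπ, altSum_succ, Finset.smul_sum]
  refine Finset.sum_congr rfl fun i _ => ?_
  rw [smul_comm]
  exact congrArg _ (altSum_cyclicWedge_logVol ω D (face i l))

lemma altSum_cyclicWedge_star_eq_tau0Val (l : Generic F V 5) :
    altSum l.1 (fun y => cyclicWedge D (logVol ω (y 0) (y 1) (y 2)) (logVol ω (y 0) (y 1) (y 3))
      (∑ k, logOf (omitVol ω (Fin.tail y) k))) =
      (6 : ℤ) • ∑ i : Fin 5, (-1 : ℤ) ^ (i : ℕ) • tau0Val D ω (face i l).1 := by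
  have h₂₃₄ : altSum l.1 (fun y => cyclicWedge D (logVol ω (y 0) (y 1) (y 2))
      (logVol ω (y 0) (y 1) (y 3)) (logVol ω (y 2) (y 3) (y 4))) = 0 :=
    altSum_eq_zero_of_odd l (π := Equiv.swap 0 1) (by decide) fun y => by
      change _ = cyclicWedge D (logVol ω (y.1 1) (y.1 0) (y.1 2))
        (logVol ω (y.1 1) (y.1 0) (y.1 3)) (logVol ω (y.1 2) (y.1 3) (y.1 4))
      simp only [logVol_swap₀₁]
  have h₁₃₄ : altSum l.1 (fun y => cyclicWedge D (logVol ω (y 0) (y 1) (y 2))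
      (logVol ω (y 0) (y 1) (y 3)) (logVol ω (y 1) (y 3) (y 4))) = 0 :=
    altSum_eq_zero_of_even l (π := Equiv.swap 0 3 * Equiv.swap 2 4) (by decide) fun y => by
      change _ = -cyclicWedge D (logVol ω (y.1 3) (y.1 1) (y.1 4))
        (logVol ω (y.1 3) (y.1 1) (y.1 0)) (logVol ω (y.1 1) (y.1 0) (y.1 2))
      simp only [logVol_swap₀₁, logVol_swap₁₂]
      exact cyclicWedge_reverse D _ _ _
  have h₁₂₄ : altSum l.1 (fun y => cyclicWedge D (logVol ω (y 0) (y 1) (y 2))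
      (logVol ω (y 0) (y 1) (y 3)) (logVol ω (y 1) (y 2) (y 4))) = 0 :=
    altSum_eq_zero_of_even l (π := Equiv.swap 0 2 * Equiv.swap 3 4) (by decide) fun y => by
      change _ = -cyclicWedge D (logVol ω (y.1 2) (y.1 1) (y.1 0))
        (logVol ω (y.1 2) (y.1 1) (y.1 4)) (logVol ω (y.1 1) (y.1 0) (y.1 3))
      simp only [logVol_swap₀₁, logVol_swap₁₂]
      exact cyclicWedge_swap_right D _ _ _
  have htail (y : Fin 5 → V) : ∑ k, logOf (omitVol ω (Fin.tail y) k) =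
      logVol ω (y 2) (y 3) (y 4) + logVol ω (y 1) (y 3) (y 4) + logVol ω (y 1) (y 2) (y 4) +
        logVol ω (y 1) (y 2) (y 3) := Fin.sum_univ_four _
  simp only [htail, cyclicWedge_add_right, altSum_add]
  rw [h₂₃₄, h₁₃₄, h₁₂₄, altSum_cyclicWedge_triangle, add_zero, add_zero, zero_add]

variable [NeZero (3 : F)]

lemma bdryMid_tau1Val (l : Generic F V 5) :
    bdryMid D (tau1Val D ω l.1) = ∑ i : Fin 5, (-1 : ℤ) ^ (i : ℕ) • tau0Val D ω (face i l).1 := by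
  have h := (altSum_cyclicWedge_star ω D l).symm.trans (altSum_cyclicWedge_star_eq_tau0Val ω D l)
  have h6 : (6 : F) ≠ 0 := by
    rw [show (6 : F) = 2 * 3 by norm_num]
    exact mul_ne_zero (NeZero.ne 2) (NeZero.ne 3)
  rw [tau1Val_eq_sum, map_smul, map_sum]
  simp only [map_zsmul]
  generalize (∑ i : Fin 5, (-1 : ℤ) ^ (i : ℕ) • tau0Val D ω (face i l).1) = T at *
  generalize (∑ i : Fin 5, (-1 : ℤ) ^ (i : ℕ) •
      bdryMid D (midPairing D (logOf (omitProd ω l.1 i))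
        (dilogOf D (projRatio ω (l.1 i) (i.removeNth l.1))))) = S at *
  have h' : (-2 : F) • S = (6 : F) • T := by
    simpa only [← Int.cast_smul_eq_zsmul F, Int.cast_neg, Int.cast_ofNat] using h
  calc (-(1 / 3) : F) • S = (1 / 6 : F) • (-2 : F) • S := by
        rw [smul_smul]
        congr 1
        field_simp [NeZero.ne (3 : F)]
        norm_num
    _ = T := by rw [h', smul_smul, one_div_mul_cancel h6, one_smul]

lemma bdryMid_comp_tau1 :
    (bdryMid D).toAddMonoidHom.comp (tau1 D ω) = (tau0 D ω).comp (grassD F V 4) := by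
  refine chain_hom_ext fun l => ?_
  rw [AddMonoidHom.comp_apply, AddMonoidHom.comp_apply, map_grassD_conf]
  simp only [tau1, tau0, chainLift_conf]
  exact bdryMid_tau1Val ω D l

end SecondSquare

section WeightedRatioSums

variable {F : Type*} [Field F] {V : Type*} [AddCommGroup V]
  [Module F V] {M N : Type*} [AddCommGroup M] [AddCommGroup N] [Module F M] [Module F N]
  (ω : VolumeForm F V) (f : F → M) (B : LogSpace F →ₗ[F] M →ₗ[F] N)

/-- The alternating sum over `l` of the values of `f` at the projected cross-ratio of
`y (e 0), …, y (e 3)` seen from `y c`, paired with the logarithm of the volume of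
`y (w 0), y (w 1), y (w 2)`. -/
def weightedRatioSum (l : Fin 6 → V) (w : Fin 3 → Fin 6) (c : Fin 6) (e : Fin 4 → Fin 6) : N :=
  altSum l fun y => B (logVol ω (y (w 0)) (y (w 1)) (y (w 2))) (f (projRatio ω (y c) (y ∘ e)))

variable {f} (l : Generic F V 6)

lemma sum_weightedRatioSum_eq_zero (w : Fin 3 → Fin 6) (c : Fin 5 → Fin 6)
    (e : Fin 5 → Fin 4 → Fin 6)
    (h : ∀ y : Generic F V 6,
      ∑ i : Fin 5, (-1 : ℤ) ^ (i : ℕ) • f (projRatio ω (y.1 (c i)) (y.1 ∘ e i)) = 0) :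
    ∑ i : Fin 5, (-1 : ℤ) ^ (i : ℕ) • weightedRatioSum ω f B l.1 w (c i) (e i) = 0 := by
  simp only [weightedRatioSum, ← map_zsmul, ← map_sum]
  refine (altSum_congr (H := fun _ => (0 : N)) l fun y => ?_).trans (map_zero _)
  simp only [Finset.sum_apply, Pi.smul_apply, ← map_zsmul, ← map_sum, h y, map_zero]

variable [Fact (Module.finrank F V = 3)] (hf : FiveTermFunction f)

include hf

lemma sum_weightedRatioSum_succ (w : Fin 3 → Fin 6) :
    ∑ i : Fin 5, (-1 : ℤ) ^ (i : ℕ) •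
      weightedRatioSum ω f B l.1 w 0 (i.removeNth Fin.succ) = 0 := by
  refine sum_weightedRatioSum_eq_zero ω B l w (fun _ => 0) _ fun y => ?_
  have h := hf.sum_projRatio ω (y.1 0) (fun i => y.1 i.succ) fun i j hij _ =>
      vol_ne_zero ω y (Fin.succ_ne_zero i).symm (Fin.succ_ne_zero j).symm
        ((Fin.succ_injective 5).ne hij.ne)
  simp only [Fin.sum_univ_five, Fin.coe_ofNat_eq_mod, Nat.reduceMod, pow_zero, pow_succ,
    mul_neg, mul_one, neg_neg, one_smul, neg_smul, ← sub_eq_add_neg]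
  exact h

lemma sum_weightedRatioSum_succAbove (w : Fin 3 → Fin 6) (j : Fin 6) :
    ∑ i : Fin 5, (-1 : ℤ) ^ (i : ℕ) •
      weightedRatioSum ω f B l.1 w (j.succAbove i) (i.removeNth j.succAbove) = 0 :=
  sum_weightedRatioSum_eq_zero ω B l w _ _ fun y => hf.sum_dual ω (face j y)

variable [NeZero (2 : F)] [NeZero (3 : F)]

section Relabel

variable (l : Fin 6 → V) {w w' : Fin 3 → Fin 6} {c c' : Fin 6} {e e' : Fin 4 → Fin 6}
  (π : Equiv.Perm (Fin 6)) (ρ : Equiv.Perm (Fin 3)) (τ : Equiv.Perm (Fin 4))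

lemma weightedRatioSum_relabel (hw : w' = π ∘ w ∘ ρ) (hc : c' = π c) (he : e' = π ∘ e ∘ τ) :
    weightedRatioSum ω f B l w' c' e' =
      (Equiv.Perm.sign π * Equiv.Perm.sign τ : ℤ) • weightedRatioSum ω f B l w c e := by
  have h (y : Fin 6 → V) : B (logVol ω (y (w' 0)) (y (w' 1)) (y (w' 2)))
      (f (projRatio ω (y c') (y ∘ e'))) = (Equiv.Perm.sign τ : ℤ) •
        B (logVol ω ((y ∘ π) (w 0)) ((y ∘ π) (w 1)) ((y ∘ π) (w 2)))
          (f (projRatio ω ((y ∘ π) c) ((y ∘ π) ∘ e))) := by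
    rw [hw, hc, he, ← map_zsmul, ← hf.map_projRatio_perm]
    exact congrArg (fun a => B a _) (logVol_comp_perm ω (y ∘ π ∘ w) ρ)
  simp only [weightedRatioSum, h, altSum_zsmul]
  rw [mul_comm, mul_smul, ← altSum_comp_perm]

lemma weightedRatioSum_eq_of_relabel (hsign : Equiv.Perm.sign π * Equiv.Perm.sign τ = 1)
    (hw : w' = π ∘ w ∘ ρ) (hc : c' = π c) (he : e' = π ∘ e ∘ τ) :
    weightedRatioSum ω f B l w' c' e' = weightedRatioSum ω f B l w c e := by
  rw [weightedRatioSum_relabel ω B hf l π ρ τ hw hc he, ← Units.val_mul, hsign, Units.val_one,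
    one_smul]

lemma weightedRatioSum_eq_neg_of_relabel (hsign : Equiv.Perm.sign π * Equiv.Perm.sign τ = -1)
    (hw : w' = π ∘ w ∘ ρ) (hc : c' = π c) (he : e' = π ∘ e ∘ τ) :
    weightedRatioSum ω f B l w' c' e' = -weightedRatioSum ω f B l w c e := by
  rw [weightedRatioSum_relabel ω B hf l π ρ τ hw hc he, ← Units.val_mul, hsign, Units.val_neg,
    Units.val_one, neg_one_smul]

end Relabel

lemma two_smul_weightedRatioSum_1423 :
    (2 : ℤ) • weightedRatioSum ω f B l.1 ![0, 2, 5] 0 ![1, 4, 2, 3] =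
      (3 : ℤ) • weightedRatioSum ω f B l.1 ![0, 2, 5] 0 ![1, 4, 2, 5] := by
  set X := weightedRatioSum ω f B l.1 ![0, 2, 5] 0 ![1, 4, 2, 3]
  set Y := weightedRatioSum ω f B l.1 ![0, 2, 5] 0 ![1, 4, 2, 5]
  have h₂₃₄₅ : weightedRatioSum ω f B l.1 ![0, 2, 5] 0 (Fin.removeNth 0 Fin.succ) = -Y :=
    weightedRatioSum_eq_neg_of_relabel ω B hf l.1 (Equiv.swap 1 3) 1
      (Equiv.swap 0 1 * Equiv.swap 0 2) (by decide) (by decide) (by decide) (by decide)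
  have h₁₃₄₅ : weightedRatioSum ω f B l.1 ![0, 2, 5] 0 (Fin.removeNth 1 Fin.succ) = -X :=
    weightedRatioSum_eq_neg_of_relabel ω B hf l.1 (Equiv.swap 2 5) (Equiv.swap 1 2)
      (Equiv.swap 1 2 * Equiv.swap 1 3) (by decide) (by decide) (by decide) (by decide)
  have h₁₂₄₅ : weightedRatioSum ω f B l.1 ![0, 2, 5] 0 (Fin.removeNth 2 Fin.succ) = -Y :=
    weightedRatioSum_eq_neg_of_relabel ω B hf l.1 1 1 (Equiv.swap 1 2) (by decide) (by decide)
      (by decide) (by decide)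
  have h₁₂₃₅ : weightedRatioSum ω f B l.1 ![0, 2, 5] 0 (Fin.removeNth 3 Fin.succ) = Y :=
    weightedRatioSum_eq_of_relabel ω B hf l.1 (Equiv.swap 3 4) 1 (Equiv.swap 1 2) (by decide)
      (by decide) (by decide) (by decide)
  have h₁₂₃₄ : weightedRatioSum ω f B l.1 ![0, 2, 5] 0 (Fin.removeNth 4 Fin.succ) = X :=
    weightedRatioSum_eq_of_relabel ω B hf l.1 1 1 (Equiv.swap 1 2 * Equiv.swap 2 3) (by decide)
      (by decide) (by decide) (by decide)
  have h := sum_weightedRatioSum_succ ω B l hf ![0, 2, 5]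
  simp only [Fin.sum_univ_five, Fin.coe_ofNat_eq_mod, Nat.reduceMod, h₂₃₄₅, h₁₃₄₅, h₁₂₄₅,
    h₁₂₃₅, h₁₂₃₄] at h
  linear_combination (norm := module) h

lemma three_smul_weightedRatioSum_1425 :
    (3 : ℤ) • weightedRatioSum ω f B l.1 ![0, 2, 5] 0 ![1, 4, 2, 5] =
      (-2 : ℤ) • weightedRatioSum ω f B l.1 ![3, 4, 5] 1 ![2, 3, 4, 5] := by
  set Y := weightedRatioSum ω f B l.1 ![0, 2, 5] 0 ![1, 4, 2, 5]
  set Z := weightedRatioSum ω f B l.1 ![3, 4, 5] 1 ![2, 3, 4, 5]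
  have h₀ : weightedRatioSum ω f B l.1 ![0, 2, 5] (Fin.succAbove 3 0)
      (Fin.removeNth 0 (Fin.succAbove 3)) = -Y :=
    weightedRatioSum_eq_neg_of_relabel ω B hf l.1 1 1 (Equiv.swap 1 2) (by decide) (by decide)
      (by decide) (by decide)
  have h₁ : weightedRatioSum ω f B l.1 ![0, 2, 5] (Fin.succAbove 3 1)
      (Fin.removeNth 1 (Fin.succAbove 3)) = Z :=
    weightedRatioSum_eq_of_relabel ω B hf l.1 (Equiv.swap 0 3 * Equiv.swap 2 4) 1
      (Equiv.swap 0 1 * Equiv.swap 1 2) (by decide) (by decide) (by decide) (by decide)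
  have h₂ : weightedRatioSum ω f B l.1 ![0, 2, 5] (Fin.succAbove 3 2)
      (Fin.removeNth 2 (Fin.succAbove 3)) = -Y :=
    weightedRatioSum_eq_neg_of_relabel ω B hf l.1 (Equiv.swap 0 2) (Equiv.swap 0 1)
      (Equiv.swap 0 1 * Equiv.swap 0 2) (by decide) (by decide) (by decide) (by decide)
  have h₃ : weightedRatioSum ω f B l.1 ![0, 2, 5] (Fin.succAbove 3 3)
      (Fin.removeNth 3 (Fin.succAbove 3)) = Z :=
    weightedRatioSum_eq_of_relabel ω B hf l.1
      (Equiv.swap 0 3 * Equiv.swap 1 2 * Equiv.swap 1 4) 1 (Equiv.swap 0 1) (by decide) (by decide)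
      (by decide) (by decide)
  have h₄ : weightedRatioSum ω f B l.1 ![0, 2, 5] (Fin.succAbove 3 4)
      (Fin.removeNth 4 (Fin.succAbove 3)) = -Y :=
    weightedRatioSum_eq_neg_of_relabel ω B hf l.1 (Equiv.swap 0 5) (Equiv.swap 0 2)
      (Equiv.swap 0 1 * Equiv.swap 0 3) (by decide) (by decide) (by decide) (by decide)
  have h := sum_weightedRatioSum_succAbove ω B l hf ![0, 2, 5] 3
  simp only [Fin.sum_univ_five, Fin.coe_ofNat_eq_mod, Nat.reduceMod, h₀, h₁, h₂, h₃, h₄] at h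
  linear_combination (norm := module) -h

end WeightedRatioSums

section Plucker

variable {F : Type*} [Field F] {V : Type*} [AddCommGroup V] [Module F V] (ω : VolumeForm F V)
  [Fact (Module.finrank F V = 3)]

lemma vol_plucker (x a b c d : V) :
    vol ω x a c * vol ω x b d - vol ω x a d * vol ω x b c = vol ω x a b * vol ω x c d := by
  obtain ⟨π, hπ⟩ := exists_projection ω x
  simp only [hπ, det2_plucker]

/-- The point of the projective plane where the line through `p` and `q` meets the line through
`b` and `c`. -/
def meet (p q b c : V) : V := vol ω b c q • p - vol ω b c p • q

omit [Fact (Module.finrank F V = 3)] in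
lemma vol_left_meet (x p q b c : V) :
    vol ω x p (meet ω p q b c) = -(vol ω b c p * vol ω x p q) := by
  rw [meet, vol_sub_smul, vol_eq_zero, mul_zero, zero_sub]

omit [Fact (Module.finrank F V = 3)] in
lemma vol_right_meet (x p q b c : V) :
    vol ω x q (meet ω p q b c) = -(vol ω b c q * vol ω x p q) := by
  rw [meet, vol_sub_smul, vol_eq_zero, mul_zero, sub_zero, vol_swap₁₂ ω x p q, mul_neg]

lemma vol_base_meet (x p q b c : V) :
    vol ω x b (meet ω p q b c) = vol ω b c x * vol ω b p q := by
  rw [meet, vol_sub_smul, ← vol_plucker, vol_swap₀₁ ω b x, vol_swap₀₁ ω b x]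
  ring

end Plucker

section TripleRatio

variable {F : Type*} [Field F] {V : Type*} [AddCommGroup V] [Module F V] (ω : VolumeForm F V)

lemma tripleRatio_comp_rotation (y : Fin 6 → V) :
    tripleRatio ω (y ∘ ![1, 2, 0, 4, 5, 3]) = tripleRatio ω y := by
  simp only [tripleRatio, Function.comp_apply, Matrix.cons_val]
  ring

lemma tripleRatio_comp_reflection (y : Fin 6 → V) :
    tripleRatio ω (y ∘ ![1, 0, 2, 4, 3, 5]) = (tripleRatio ω y)⁻¹ := by
  simp only [tripleRatio, Function.comp_apply, Matrix.cons_val, inv_div]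
  rw [vol_swap₀₁ ω (y 0) (y 1), vol_swap₀₁ ω (y 2) (y 0), vol_swap₀₁ ω (y 1) (y 2),
    vol_swap₀₁ ω (y 0) (y 1), vol_swap₀₁ ω (y 2) (y 0), vol_swap₀₁ ω (y 1) (y 2)]
  ring

variable [Fact (Module.finrank F V = 3)]

lemma logOf_tripleRatio (y : Generic F V 6) :
    logOf (tripleRatio ω y.1) =
      logVol ω (y.1 0) (y.1 1) (y.1 3) + logVol ω (y.1 1) (y.1 2) (y.1 4) +
        logVol ω (y.1 2) (y.1 0) (y.1 5) -
      (logVol ω (y.1 0) (y.1 1) (y.1 4) + logVol ω (y.1 1) (y.1 2) (y.1 5) +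
        logVol ω (y.1 2) (y.1 0) (y.1 3)) := by
  have hne {i j k : Fin 6} := vol_ne_zero ω y (i := i) (j := j) (k := k)
  have h₀₁₃ := hne (i := 0) (j := 1) (k := 3) (by decide) (by decide) (by decide)
  have h₁₂₄ := hne (i := 1) (j := 2) (k := 4) (by decide) (by decide) (by decide)
  have h₂₀₅ := hne (i := 2) (j := 0) (k := 5) (by decide) (by decide) (by decide)
  have h₀₁₄ := hne (i := 0) (j := 1) (k := 4) (by decide) (by decide) (by decide)
  have h₁₂₅ := hne (i := 1) (j := 2) (k := 5) (by decide) (by decide) (by decide)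
  have h₂₀₃ := hne (i := 2) (j := 0) (k := 3) (by decide) (by decide) (by decide)
  have hnum := mul_ne_zero h₀₁₃ h₁₂₄
  have hden := mul_ne_zero h₀₁₄ h₁₂₅
  rw [tripleRatio, logOf_div (mul_ne_zero hnum h₂₀₅) (mul_ne_zero hden h₂₀₃),
    logOf_mul hnum h₂₀₅, logOf_mul h₀₁₃ h₁₂₄, logOf_mul hden h₂₀₃, logOf_mul h₀₁₄ h₁₂₅]
  rfl

lemma projRatio_meet_eq_tripleRatio (y : Fin 6 → V) :
    projRatio ω (y 0) ![y 1, y 2, meet ω (y 1) (y 4) (y 2) (y 5), y 3] = tripleRatio ω y := by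
  simp only [projRatio, tripleRatio, Matrix.cons_val, vol_left_meet, vol_base_meet]
  rw [vol_swap₁₂ ω (y 2) (y 0) (y 5), vol_swap₀₁ ω (y 1) (y 2), vol_swap₁₂ ω (y 2) (y 1) (y 5),
    vol_swap₀₁ ω (y 0) (y 2), vol_swap₀₁ ω (y 1) (y 2), vol_swap₀₁ ω (y 0) (y 2) (y 3)]
  ring

lemma projRatio_meet_eq_tripleRatio_swap (y : Fin 6 → V) :
    projRatio ω (y 0) ![y 4, y 2, meet ω (y 1) (y 4) (y 2) (y 5), y 3] =
      tripleRatio ω (y ∘ Equiv.swap 1 4) := by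
  refine Eq.trans ?_ (projRatio_meet_eq_tripleRatio ω (y ∘ Equiv.swap 1 4))
  change _ = projRatio ω (y 0) ![y 4, y 2, meet ω (y 4) (y 1) (y 2) (y 5), y 3]
  simp only [projRatio, Matrix.cons_val, vol_left_meet, vol_right_meet, vol_base_meet,
    vol_swap₁₂ ω _ (y 4) (y 1)]
  ring

variable {M : Type*} [AddCommGroup M] {f : F → M}

lemma FiveTermFunction.map_tripleRatio (hf : FiveTermFunction f) (l : Generic F V 6) :
    f (tripleRatio ω l.1) = f (tripleRatio ω (l.1 ∘ Equiv.swap 1 4)) +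
      f (vol ω (l.1 0) (l.1 1) (l.1 3) * vol ω (l.1 2) (l.1 5) (l.1 4) /
        (vol ω (l.1 2) (l.1 5) (l.1 1) * vol ω (l.1 0) (l.1 4) (l.1 3))) -
      f (projRatio ω (l.1 0) (l.1 ∘ ![1, 4, 2, 3])) +
      f (projRatio ω (l.1 2) (l.1 ∘ ![1, 4, 0, 5])) := by
  have hne {i j k : Fin 6} := vol_ne_zero ω l (i := i) (j := j) (k := k)
  have h₀₁₄ := hne (i := 0) (j := 1) (k := 4) (by decide) (by decide) (by decide)
  generalize l.1 = y at *
  -- Five-term relation for the projections from `y 0` of `y 1`, `y 4`, `y 2`, `m` and `y 3`.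
  set m : V := meet ω (y 1) (y 4) (y 2) (y 5)
  have e₁₄ : projRatio ω (y 0) ![y 1, y 4, m, y 3] = vol ω (y 0) (y 1) (y 3) *
      vol ω (y 2) (y 5) (y 4) / (vol ω (y 2) (y 5) (y 1) * vol ω (y 0) (y 4) (y 3)) := by
    simp only [projRatio, Matrix.cons_val, m, vol_left_meet, vol_right_meet]
    field_simp
  have e₁₀ : projRatio ω (y 0) ![y 1, y 4, y 2, m] = projRatio ω (y 2) (y ∘ ![1, 4, 0, 5]) := by
    simp only [projRatio, Matrix.cons_val, Function.comp_apply, m, vol_left_meet, vol_right_meet]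
    rw [vol_swap₁₂ ω (y 0) (y 2) (y 4), vol_swap₁₂ ω (y 2) (y 0) (y 4),
      vol_swap₀₁ ω (y 0) (y 2) (y 4), vol_swap₁₂ ω (y 2) (y 0) (y 1),
      vol_swap₀₁ ω (y 0) (y 2) (y 1), vol_swap₁₂ ω (y 0) (y 1) (y 2),
      vol_swap₁₂ ω (y 2) (y 1) (y 5), vol_swap₁₂ ω (y 2) (y 4) (y 5)]
    field_simp
  have hz (i j : Fin 5) (hij : i < j) (h : (i, j) ≠ (3, 4)) :
      vol ω (y 0) (![y 1, y 4, y 2, m, y 3] i) (![y 1, y 4, y 2, m, y 3] j) ≠ 0 := by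
    fin_cases i <;> fin_cases j <;> first | exact absurd hij (by decide) | exact absurd rfl h | skip
    all_goals simp [m, vol_left_meet, vol_right_meet, vol_base_meet, hne]
  have e₁₃ : projRatio ω (y 0) ![y 1, y 4, y 2, y 3] = projRatio ω (y 0) (y ∘ ![1, 4, 2, 3]) := rfl
  have h := hf.sum_projRatio ω (y 0) ![y 1, y 4, y 2, m, y 3] hz
  simp only [Matrix.cons_val, projRatio_meet_eq_tripleRatio, projRatio_meet_eq_tripleRatio_swap,
    e₁₄, e₁₃, e₁₀, m] at h
  rw [← sub_eq_zero, ← neg_eq_zero, ← h]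
  abel

end TripleRatio

section TripleRatioSums

variable {F : Type*} [Field F] {V : Type*} [AddCommGroup V]
  [Module F V] {M N : Type*} [AddCommGroup M] [AddCommGroup N] [Module F M] [Module F N]
  (ω : VolumeForm F V) (f : F → M) (B : LogSpace F →ₗ[F] M →ₗ[F] N)

/-- The alternating sum over `l` of the values of `f` at the triple ratio of `y`, paired with the
logarithm of the volume of `y (w 0), y (w 1), y (w 2)`. -/
def tripleRatioSum (l : Fin 6 → V) (w : Fin 3 → Fin 6) : N :=
  altSum l fun y => B (logVol ω (y (w 0)) (y (w 1)) (y (w 2))) (f (tripleRatio ω y))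

lemma tripleRatioSum_rotation (l : Generic F V 6) {w w' : Fin 3 → Fin 6}
    (hw : w' = ![1, 2, 0, 4, 5, 3] ∘ w) :
    tripleRatioSum ω f B l.1 w' = tripleRatioSum ω f B l.1 w := by
  let π : Equiv.Perm (Fin 6) :=
    Equiv.swap 0 1 * Equiv.swap 1 2 * (Equiv.swap 3 4 * Equiv.swap 4 5)
  have coe_π : ⇑π = ![1, 2, 0, 4, 5, 3] := by decide
  have sign_π : Equiv.Perm.sign π = 1 := by decide
  refine (altSum_eq_smul_of_comp_perm l π fun y => ?_).trans (by rw [sign_π]; exact one_smul _ _)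
  rw [hw, coe_π, tripleRatio_comp_rotation]
  rfl

variable {f} [NeZero (2 : F)]

lemma tripleRatioSum_comp_perm (l : Fin 6 → V) {w w' : Fin 3 → Fin 6} (ρ : Equiv.Perm (Fin 3))
    (hw : w' = w ∘ ρ) : tripleRatioSum ω f B l w' = tripleRatioSum ω f B l w := by
  have h (y : Fin 6 → V) := logVol_comp_perm ω (y ∘ w) ρ
  simp only [Function.comp_apply] at h
  simp only [tripleRatioSum, hw, Function.comp_apply, h]

variable [NeZero (3 : F)] (hf : FiveTermFunction f) (l : Generic F V 6)

include hf

lemma tripleRatioSum_reflection {w w' : Fin 3 → Fin 6}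
    (hw : w' = ![1, 0, 2, 4, 3, 5] ∘ w) :
    tripleRatioSum ω f B l.1 w' = -tripleRatioSum ω f B l.1 w := by
  let π : Equiv.Perm (Fin 6) := Equiv.swap 0 1 * Equiv.swap 3 4
  have coe_π : ⇑π = ![1, 0, 2, 4, 3, 5] := by decide
  have sign_π : Equiv.Perm.sign π = 1 := by decide
  rw [tripleRatioSum, tripleRatioSum, ← map_neg]
  refine (altSum_eq_smul_of_comp_perm l π fun y => ?_).trans (by rw [sign_π]; exact one_smul _ _)
  rw [hw, coe_π, Pi.neg_apply, tripleRatio_comp_reflection, hf.map_inv, map_neg, neg_neg]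
  rfl

variable [Fact (Module.finrank F V = 3)]

lemma two_smul_tripleRatioSum :
    (2 : ℤ) • tripleRatioSum ω f B l.1 ![0, 2, 5] =
      -weightedRatioSum ω f B l.1 ![0, 2, 5] 0 ![1, 4, 2, 3] -
        weightedRatioSum ω f B l.1 ![0, 2, 5] 0 ![1, 4, 2, 5] := by
  let b (y : Fin 6 → V) : M →ₗ[F] N := B (logVol ω (y 0) (y 2) (y 5))
  let G (y : Fin 6 → V) : N := b y (f (tripleRatio ω y))
  let S (y : Fin 6 → V) : N := b y (f (vol ω (y 0) (y 1) (y 3) * vol ω (y 2) (y 5) (y 4) /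
    (vol ω (y 2) (y 5) (y 1) * vol ω (y 0) (y 4) (y 3))))
  let P (y : Fin 6 → V) : N := b y (f (projRatio ω (y 0) (y ∘ ![1, 4, 2, 3])))
  let Q (y : Fin 6 → V) : N := b y (f (projRatio ω (y 2) (y ∘ ![1, 4, 0, 5])))
  have hG : altSum l.1 G = altSum l.1 ((fun y => G (y ∘ Equiv.swap 1 4)) + S - P + Q) :=
    altSum_congr l fun y => by
      change b y.1 _ = b y.1 _ + b y.1 _ - b y.1 _ + b y.1 _
      rw [hf.map_tripleRatio ω y, map_add, map_sub, map_add]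
  have hswap : altSum l.1 (fun y => G (y ∘ Equiv.swap 1 4)) = -altSum l.1 G := by
    rw [altSum_comp_perm, Equiv.Perm.sign_swap (by decide), Units.val_neg, Units.val_one,
      neg_one_smul]
  have hS : altSum l.1 S = 0 :=
    altSum_eq_zero_of_odd l (π := Equiv.swap 2 5) (by decide) fun y => by
      change _ = B (logVol ω (y.1 0) (y.1 5) (y.1 2)) (f (vol ω (y.1 0) (y.1 1) (y.1 3) *
        vol ω (y.1 5) (y.1 2) (y.1 4) / (vol ω (y.1 5) (y.1 2) (y.1 1) *
          vol ω (y.1 0) (y.1 4) (y.1 3))))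
      rw [logVol_swap₁₂, vol_swap₀₁ ω (y.1 2), vol_swap₀₁ ω (y.1 2), mul_neg, neg_mul,
        neg_div_neg_eq]
  have hQ : weightedRatioSum ω f B l.1 ![0, 2, 5] 2 ![1, 4, 0, 5] =
      -weightedRatioSum ω f B l.1 ![0, 2, 5] 0 ![1, 4, 2, 5] :=
    weightedRatioSum_eq_neg_of_relabel ω B hf l.1 (Equiv.swap 0 2) (Equiv.swap 0 1) 1 (by decide)
      (by decide) (by decide) (by decide)
  rw [map_add, map_sub, map_add, hswap, hS] at hG
  change altSum l.1 Q = _ at hQ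
  rw [hQ] at hG
  change (2 : ℤ) • altSum l.1 G = -altSum l.1 P - _
  linear_combination (norm := module) hG

lemma six_smul_tripleRatioSum :
    (6 : ℤ) • tripleRatioSum ω f B l.1 ![0, 2, 5] =
      (5 : ℤ) • weightedRatioSum ω f B l.1 ![3, 4, 5] 1 ![2, 3, 4, 5] := by
  have hXYZ := two_smul_tripleRatioSum ω B hf l
  have hXY := two_smul_weightedRatioSum_1423 ω B l hf
  have hYZ := three_smul_weightedRatioSum_1425 ω B l hf
  refine sub_eq_zero.mp (eq_zero_of_eq_neg F ?_)
  linear_combination (norm := module) (6 : ℤ) • hXYZ - (3 : ℤ) • hXY - (5 : ℤ) • hYZ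

lemma altSum_logOf_tripleRatio :
    altSum l.1 (fun y => B (logOf (tripleRatio ω y)) (f (tripleRatio ω y))) =
      (6 : ℤ) • tripleRatioSum ω f B l.1 ![0, 2, 5] := by
  have h : altSum l.1 (fun y => B (logOf (tripleRatio ω y)) (f (tripleRatio ω y))) =
      tripleRatioSum ω f B l.1 ![0, 1, 3] + tripleRatioSum ω f B l.1 ![1, 2, 4] +
        tripleRatioSum ω f B l.1 ![2, 0, 5] - (tripleRatioSum ω f B l.1 ![0, 1, 4] +
        tripleRatioSum ω f B l.1 ![1, 2, 5] + tripleRatioSum ω f B l.1 ![2, 0, 3]) := by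
    simp only [tripleRatioSum, ← map_add, ← map_sub]
    refine altSum_congr l fun y => ?_
    rw [logOf_tripleRatio]
    simp only [map_add, map_sub, LinearMap.add_apply, LinearMap.sub_apply,
      Pi.add_apply, Pi.sub_apply]
    rfl
  have h₀₁₃ : tripleRatioSum ω f B l.1 ![0, 1, 3] = tripleRatioSum ω f B l.1 ![2, 0, 5] :=
    tripleRatioSum_rotation ω f B l (by decide)
  have h₁₂₄ : tripleRatioSum ω f B l.1 ![1, 2, 4] = tripleRatioSum ω f B l.1 ![0, 1, 3] :=
    tripleRatioSum_rotation ω f B l (by decide)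
  have h₀₁₄ : tripleRatioSum ω f B l.1 ![0, 1, 4] = tripleRatioSum ω f B l.1 ![2, 0, 3] :=
    tripleRatioSum_rotation ω f B l (by decide)
  have h₁₂₅ : tripleRatioSum ω f B l.1 ![1, 2, 5] = tripleRatioSum ω f B l.1 ![0, 1, 4] :=
    tripleRatioSum_rotation ω f B l (by decide)
  have h₁₂₅' : tripleRatioSum ω f B l.1 ![1, 2, 5] = -tripleRatioSum ω f B l.1 ![0, 2, 5] :=
    tripleRatioSum_reflection ω B hf l (by decide)
  have h₂₀₅ : tripleRatioSum ω f B l.1 ![2, 0, 5] = tripleRatioSum ω f B l.1 ![0, 2, 5] :=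
    tripleRatioSum_comp_perm ω B l.1 (Equiv.swap 0 1) (by decide)
  rw [h, h₁₂₄, h₀₁₃, ← h₀₁₄, ← h₁₂₅, h₁₂₅', h₂₀₅]
  module

lemma altSum_logVol_projRatio (x : V) (z : Fin 4 → V) :
    altSum z (fun y => B (logVol ω (y 1) (y 2) (y 3)) (f (projRatio ω x y))) =
      (6 : ℤ) • B (∑ k, logOf (omitVol ω z k)) (f (projRatio ω x z)) := by
  have h (σ : Equiv.Perm (Fin 4)) : (Equiv.Perm.sign σ : ℤ) •
      B (logVol ω ((z ∘ σ) 1) ((z ∘ σ) 2) ((z ∘ σ) 3)) (f (projRatio ω x (z ∘ σ))) =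
        B (logOf (omitVol ω z (σ 0))) (f (projRatio ω x z)) := by
    rw [hf.map_projRatio_perm, map_zsmul, smul_smul, Int.units_coe_mul_self, one_smul,
      ← logOf_omitVol_comp_perm]
    rfl
  rw [altSum_apply, Finset.sum_congr rfl fun σ _ => h σ,
    sum_perm_apply_zero fun k => B (logOf (omitVol ω z k)) (f (projRatio ω x z)), map_sum,
    LinearMap.sum_apply, ← natCast_zsmul]
  rfl

lemma weightedRatioSum_2345 :
    weightedRatioSum ω f B l.1 ![3, 4, 5] 1 ![2, 3, 4, 5] =
      (6 : ℤ) • ∑ j : Fin 6, (-1 : ℤ) ^ (j : ℕ) • ∑ i : Fin 5, (-1 : ℤ) ^ (i : ℕ) •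
        B (logOf (omitProd ω (face j l).1 i))
          (f (projRatio ω ((face j l).1 i) (i.removeNth (face j l).1))) := by
  rw [weightedRatioSum, altSum_succ, Finset.smul_sum]
  refine Finset.sum_congr rfl fun j _ => ?_
  rw [smul_comm]
  congr 1
  refine (altSum_succ (face j l).1 fun y : Fin 5 → V =>
    B (logVol ω (y 2) (y 3) (y 4)) (f (projRatio ω (y 0) (Fin.tail y)))).trans ?_
  rw [Finset.smul_sum]
  refine Finset.sum_congr rfl fun i _ => ?_
  rw [smul_comm, logOf_omitProd, ← altSum_logVol_projRatio ω B hf]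
  rfl

lemma altSum_logOf_tripleRatio_eq_sum_faces :
    altSum l.1 (fun y => B (logOf (tripleRatio ω y)) (f (tripleRatio ω y))) =
      (30 : ℤ) • ∑ j : Fin 6, (-1 : ℤ) ^ (j : ℕ) • ∑ i : Fin 5, (-1 : ℤ) ^ (i : ℕ) •
        B (logOf (omitProd ω (face j l).1 i))
          (f (projRatio ω ((face j l).1 i) (i.removeNth (face j l).1))) := by
  rw [altSum_logOf_tripleRatio ω B hf, six_smul_tripleRatioSum ω B hf,
    weightedRatioSum_2345 ω B hf, smul_smul]
  norm_num

end TripleRatioSums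

section FirstSquare

variable {F : Type*} [Field F] (D : Derivation ℤ F F)

lemma bdry3_symb3_eq_midPairing (x : F) :
    bdry3 D (symb3 D x) = midPairing D (logOf x) (dilogOf D x) := by
  rw [midPairing_logOf_dilogOf]
  by_cases h : x = 0 ∨ x = 1
  · have h₂ : symb2 D x = 0 := Subtype.ext (by rcases h with rfl | rfl <;> simp [symb2, symb])
    rw [h₂]
    rcases h with rfl | rfl <;> simp [symb3, symb, symbB2, intSymb] <;> rfl
  · rw [not_or] at h
    exact bdry3_symb3 D h.1 h.2

variable [NeZero (2 : F)] [NeZero (3 : F)] [NeZero (5 : F)]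
  {V : Type*} [AddCommGroup V] [Module F V] (ω : VolumeForm F V)
  [Fact (Module.finrank F V = 3)]

lemma bdry3_tau2Val (l : Generic F V 6) :
    bdry3 D (tau2Val D ω l.1) = ∑ j : Fin 6, (-1 : ℤ) ^ (j : ℕ) • tau1Val D ω (face j l).1 := by
  have h90 : (90 : F) ≠ 0 := by
    rw [show (90 : F) = 2 * 3 * 3 * 5 by norm_num]
    exact mul_ne_zero (mul_ne_zero (mul_ne_zero (NeZero.ne 2) (NeZero.ne 3)) (NeZero.ne 3))
      (NeZero.ne 5)
  have h := altSum_logOf_tripleRatio_eq_sum_faces ω (midPairing D) (dilogOf_fiveTerm D) l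
  rw [← Int.cast_smul_eq_zsmul F] at h
  have hscalar : (-(1 / 90) : F) * (30 : ℤ) = -(1 / 3) := by
    field_simp [NeZero.ne (3 : F)]
    norm_num
  calc bdry3 D (tau2Val D ω l.1) = (-(1 / 90) : F) • altSum l.1 fun y =>
        midPairing D (logOf (tripleRatio ω y)) (dilogOf D (tripleRatio ω y)) := by
        simp only [tau2Val, map_smul, map_sum, map_zsmul, bdry3_symb3_eq_midPairing]
        rfl
    _ = _ := by
        rw [h, smul_smul, hscalar, Finset.smul_sum]
        refine Finset.sum_congr rfl fun j _ => ?_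
        rw [smul_comm, tau1Val_eq_sum]

lemma bdry3_comp_tau2 :
    (bdry3 D).toAddMonoidHom.comp (tau2 D ω) = (tau1 D ω).comp (grassD F V 5) := by
  refine chain_hom_ext fun l => ?_
  rw [AddMonoidHom.comp_apply, AddMonoidHom.comp_apply, map_grassD_conf]
  simp only [tau2, tau1, chainLift_conf]
  rw [LinearMap.toAddMonoidHom_coe, bdry3_tau2Val]

end FirstSquare

end WeightThree

end

open WeightThree in
theorem mainTheorem3 {F : Type*} [Field F] [NeZero (2 : F)] [NeZero (3 : F)] [NeZero (5 : F)]
    (D : Derivation ℤ F F) {V : Type*} [AddCommGroup V] [Module F V]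
    [Fact (Module.finrank F V = 3)] (ω : VolumeForm F V) :
    -- both rows are complexes
    (grassD F V 4).comp (grassD F V 5) = 0 ∧
    bdryMid D ∘ₗ bdry3 D = 0 ∧
    -- both squares commute
    (bdry3 D).toAddMonoidHom.comp (tau2 D ω) = (tau1 D ω).comp (grassD F V 5) ∧
    (bdryMid D).toAddMonoidHom.comp (tau1 D ω) = (tau0 D ω).comp (grassD F V 4) :=
  ⟨grassD_comp_grassD 4, bdryMid_comp_bdry3 D, bdry3_comp_tau2 D ω, bdryMid_comp_tau1 ω D⟩
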